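/- Let $\Omega\subset\mathbb R^3$ be a bounded Lipschitz domain, and let $M\in\mathbb R$, $\rho>0$. Then there is a constant $C>0$, depending only on $\Omega$, $M$ and $\rho$, and for every $\delta>0$ there is $\varepsilon_0>0$, depending only on $\Omega$, $M$, $\rho$ and $\delta$, such that the following holds. Let $\gamma:\mathbb R/L\mathbb Z\to\Omega$ (for some $L>0$) be a regular embedded closed $C^2$-curve with $$\|\gamma\|_{C^2}=\sup|\gamma|+\sup|\gamma'|+\sup|\gamma''|\le M,$$ with embeddedness radius at least $\rho$, and with $\mathrm{dist}(\gamma,\partial\Omega)\ge\delta$. Then for all $0<\varepsilon<\varepsilon_0$ and all $u\in H^1(\Omega_\varepsilon;\mathbb R^3)$ $$\int_{\Omega_\varepsilon}\Big|u(x)-\frac{1}{|\Omega_\varepsilon|}\int_{\Omega_\varepsilon}u\Big|^2\,dx\;\le\; C\int_{\Omega_\varepsilon}|\nabla u|^2\,dx .$$ Here $\Omega_\varepsilon=\Omega\setminus B_\varepsilon(\gamma)$ with $B_\varepsilon(\gamma)=\{x:\mathrm{dist}(x,\gamma)<\varepsilon\}$; $H^1(\Omega_\varepsilon;\mathbb{R}^3)$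 is the Sobolev space of square-integrable maps with square-integrable weak gradient (weak derivatives taken in the interior of $\Omega_\varepsilon$), and $|\nabla u|$ is the Frobenius norm. The embeddedness radius of $\gamma$ is the supremum of all $r>0$ for which the map $(s,v_1,v_2)\mapsto\gamma(s)+v_1n_1(s)+v_2n_2(s)$ is a $C^1$-diffeomorphism of $(\mathbb R/L\mathbb Z)\times\{v\in\mathbb R^2:|v|<r\}$ onto its image, where $n_1,n_2$ are $C^1$ vector fields along $\gamma$ (that is, on $\mathbb R/L\mathbb Z$) which together with the unit tangent $\gamma'/|\gamma'|$ form an orthonormal basis at every point (the supremum does not depend on the choice of $n_1,n_2$). -/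

import Mathlib

open Set MeasureTheory
open scoped ENNReal NNReal Manifold ContDiff

noncomputable section

namespace DislocationPoincare

/-- Euclidean three-space. -/
abbrev E3 : Type := EuclideanSpace ℝ (Fin 3)

/-- The Euclidean plane. -/
abbrev E2 : Type := EuclideanSpace ℝ (Fin 2)

/-- A bounded Lipschitz domain in `ℝ³`: a bounded, open, connected, non-empty set such that, near
each of its boundary points and after a linear isometric change of coordinates, it is the set of
the points above the graph of a Lipschitz function of two variables. -/
structure IsBoundedLipschitzDomain (Ω : Set E3) : Prop where
  isOpen : IsOpen Ω
  isConnected : IsConnected Ω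
  isBounded : Bornology.IsBounded Ω
  lipschitz_boundary : ∀ p ∈ frontier Ω, ∃ U : Set E3, IsOpen U ∧ p ∈ U ∧
    ∃ (A : E3 ≃ₗᵢ[ℝ] E3) (K : ℝ≥0) (h : E2 → ℝ), LipschitzWith K h ∧
      ∀ x ∈ U, (x ∈ Ω ↔ h !₂[A x 0, A x 1] < A x 2)

/-- An embedded closed `C²`-curve in `ℝ³`, as an `L`-periodic map on `ℝ` (that is, a map on the
circle `ℝ / Lℤ`) which is twice continuously differentiable, regular and injective modulo `L`.
The parametrization need not be by arc length. -/
structure IsEmbeddedClosedCurve (γ : ℝ → E3) (L : ℝ) : Prop where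
  period_pos : 0 < L
  periodic : Function.Periodic γ L
  contDiff : ContDiff ℝ 2 γ
  regular : ∀ s, deriv γ s ≠ 0
  injOn : InjOn γ (Ico 0 L)

/-- The `C²`-norm `sup |γ| + sup |γ'| + sup |γ''|`. -/
def cTwoNorm (γ : ℝ → E3) : ℝ :=
  (⨆ s, ‖γ s‖) + (⨆ s, ‖deriv γ s‖) + ⨆ s, ‖iteratedDeriv 2 γ s‖

/-- The unit tangent `γ' / |γ'|`. -/
def unitTangent (γ : ℝ → E3) (s : ℝ) : E3 := ‖deriv γ s‖⁻¹ • deriv γ s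

/-- `n₁, n₂` are `C¹` vector fields on the circle `ℝ / Lℤ` which together with the unit tangent
of `γ` form an orthonormal basis of `ℝ³` at every point. -/
structure IsNormalFrame (γ : ℝ → E3) (L : ℝ) (n₁ n₂ : ℝ → E3) : Prop where
  contDiff₁ : ContDiff ℝ 1 n₁
  contDiff₂ : ContDiff ℝ 1 n₂
  periodic₁ : Function.Periodic n₁ L
  periodic₂ : Function.Periodic n₂ L
  orthonormal : ∀ s, Orthonormal ℝ ![unitTangent γ s, n₁ s, n₂ s]

/-- The map `Φ(s, v) = γ(s) + v₁ n₁(s) + v₂ n₂(s)`. -/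
def tubeMap (γ n₁ n₂ : ℝ → E3) (q : ℝ × E2) : E3 :=
  γ q.1 + q.2 0 • n₁ q.1 + q.2 1 • n₂ q.1

/-- `Φ` is a `C¹`-diffeomorphism from `(ℝ / Lℤ) × D_r` onto its image, `D_r` being the open disk of
radius `r` about the origin: it is injective on `(ℝ / Lℤ) × D_r` and a `C¹` local diffeomorphism.
The latter property is stated on the cover `ℝ × D_r`, whose projection to `(ℝ / Lℤ) × D_r` is
itself a local diffeomorphism. -/
def IsTubeDiffeo (γ : ℝ → E3) (L : ℝ) (n₁ n₂ : ℝ → E3) (r : ℝ) : Prop :=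
  InjOn (tubeMap γ n₁ n₂) (Ico 0 L ×ˢ Metric.ball (0 : E2) r) ∧
    IsLocalDiffeomorphOn 𝓘(ℝ, ℝ × E2) 𝓘(ℝ, E3) 1 (tubeMap γ n₁ n₂)
      (univ ×ˢ Metric.ball (0 : E2) r)

/-- The embeddedness radius: the supremum of all `r > 0` for which `Φ` is a diffeomorphism from
`(ℝ / Lℤ) × D_r` onto its image. It does not depend on the normal frame used, since two frames
differ by a rotation of each normal plane (and possibly a reflection). -/
def embeddednessRadius (γ : ℝ → E3) (L : ℝ) : ℝ≥0∞ :=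
  sSup {R : ℝ≥0∞ | ∃ r : ℝ, 0 < r ∧ R = ENNReal.ofReal r ∧
    ∃ n₁ n₂ : ℝ → E3, IsNormalFrame γ L n₁ n₂ ∧ IsTubeDiffeo γ L n₁ n₂ r}

/-- `Ω_ε = Ω ∖ B_ε(γ)`, with `B_ε(γ)` the set of points at distance less than `ε` from the trace
of `γ`. -/
def tubeComplement (Ω : Set E3) (γ : ℝ → E3) (ε : ℝ) : Set E3 :=
  Ω \ Metric.thickening ε (range γ)

/-- `u ∈ H¹(S; ℝ³)` with weak partial derivatives `Du 0, Du 1, Du 2`: all four maps are square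
integrable on `S`, and integration by parts holds against all smooth `φ` with compact support in
the interior of `S`. -/
structure IsSobolevH1 (S : Set E3) (u : E3 → E3) (Du : Fin 3 → E3 → E3) : Prop where
  memLp : MemLp u 2 (volume.restrict S)
  memLp_grad : ∀ j, MemLp (Du j) 2 (volume.restrict S)
  weak_deriv : ∀ (j : Fin 3) (φ : E3 → ℝ), ContDiff ℝ ∞ φ → HasCompactSupport φ →
    tsupport φ ⊆ interior S →
      ∫ x in S, (fderiv ℝ φ x (EuclideanSpace.single j 1)) • u x = -∫ x in S, φ x • Du j x

end DislocationPoincare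

end

namespace DislocationPoincare

/-! The difficulty is a constant that does not see the thin removed tube. No Sobolev extension into
the tube is built; everything is phrased through translations.

On an open set `U`, a Sobolev function has increments over `h` bounded in mean square by `‖h‖` times
the gradient norm, at the points whose segment stays in `U`
(`lintegral_segSet_sub_sq_le_of_weak_deriv`). Conversely, such bounds alone give a Poincaré
inequality on a fixed bounded Lipschitz domain: oscillation on a ball is an average over
translations, balls chain together by connectedness, boundary points are pushed inward, and
compactness leaves finitely many pieces (`exists_linked_self_ball`). The admitted factor is `(‖h‖ +
1) ^ 2`, so a function that jumps at small scales still qualifies.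

It therefore suffices to replace `u` outside the tube by some `v` on all of `Ω` with a translation
bound uniform in `ε`. Take `v x = u (x + σ x)`, where `σ` is measurable, takes boundedly many values
of length at most `3 ε`, and moves every point to distance at least `2 ε` from the curve
(`HasTangentBalls.exists_shift`). Since `ε` is small against `ρ`, the curve is nearly straight at
scale `ε`, and two nearby points off it are joined by three short segments avoiding the tube
(`HasTangentBalls.exists_detour`). An increment of `v` over `‖h‖ ≤ ε` thus splits into three
increments of `u` along admissible segments. Summing over all possible shifts removes the dependence
on the point, and integration gives the bound (`HasTangentBalls.translationBound`).

The Poincaré inequality for `v`, the closeness of `u` to `v` and the near-optimality of the mean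
conclude. The constant comes from `Ω` and the number of directions only. -/

/-! ### Translation estimates for weakly differentiable functions -/

/-- The points `x` for which the whole segment from `x` to `x + h` lies in `U`. -/
def segSet (U : Set E3) (h : E3) : Set E3 := {x | ∀ t ∈ Icc (0 : ℝ) 1, x + t • h ∈ U}

lemma isOpen_segSet {U : Set E3} (hU : IsOpen U) (h : E3) : IsOpen (segSet U h) := by
  have hpre : IsOpen {p : E3 × ℝ | p.1 + p.2 • h ∈ U} := hU.preimage (by fun_prop)
  rw [isOpen_iff_mem_nhds]
  intro x hx
  obtain ⟨V, W, hV, -, hxV, hIW, hVW⟩ := generalized_tube_lemma (isCompact_singleton (x := x))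
    (isCompact_Icc (a := (0 : ℝ)) (b := 1)) hpre
    (by rintro ⟨y, t⟩ ⟨rfl, ht⟩; exact hx t ht)
  filter_upwards [hV.mem_nhds (hxV rfl)] with y hy t ht
  exact hVW (⟨hy, hIW ht⟩ : (y, t) ∈ V ×ˢ W)

lemma sq_lintegral_le {α : Type*} [MeasurableSpace α] (μ : Measure α) {f : α → ℝ≥0∞}
    (hf : AEMeasurable f μ) : (∫⁻ a, f a ∂μ) ^ 2 ≤ μ univ * ∫⁻ a, f a ^ 2 ∂μ := by
  have h := ENNReal.lintegral_mul_le_Lp_mul_Lq μ Real.HolderConjugate.two_two hf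
    (aemeasurable_const (b := (1 : ℝ≥0∞)))
  simp only [Pi.mul_apply, mul_one, ENNReal.one_rpow, lintegral_const, one_mul] at h
  have h2 : (∫⁻ a, f a ∂μ) ^ 2 ≤
      ((∫⁻ a, f a ^ (2 : ℝ) ∂μ) ^ (1 / 2 : ℝ) * μ univ ^ (1 / 2 : ℝ)) ^ 2 := by gcongr
  refine h2.trans (le_of_eq ?_)
  rw [mul_pow, ← ENNReal.rpow_natCast, ← ENNReal.rpow_natCast, ← ENNReal.rpow_mul,
    ← ENNReal.rpow_mul]
  norm_num [mul_comm]

lemma measurePreserving_shear (h : E3) :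
    MeasurePreserving (fun p : ℝ × E3 => (p.1, p.2 + p.1 • h))
      ((volume.restrict (Icc (0 : ℝ) 1)).prod (volume : Measure E3))
      ((volume.restrict (Icc (0 : ℝ) 1)).prod (volume : Measure E3)) :=
  (MeasurePreserving.id (volume.restrict (Icc (0 : ℝ) 1))).skew_product
    (g := fun (t : ℝ) (x : E3) => x + t • h) (by fun_prop)
    (Filter.Eventually.of_forall fun t => (measurePreserving_add_right volume (t • h)).map_eq)

/-- The difference is moved onto `φ`, written as an integral of the derivative along the segment,
and the weak derivative is tested against each translate of `φ`. This avoids mollifying `u`. -/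
lemma integral_smul_translate_sub {U : Set E3} {u g : E3 → E3} (hu : Integrable u)
    (hg : Integrable g) (h : E3)
    (hw : ∀ φ : E3 → ℝ, ContDiff ℝ ∞ φ → HasCompactSupport φ → tsupport φ ⊆ U →
      ∫ x, (fderiv ℝ φ x h) • u x = -∫ x, φ x • g x)
    {φ : E3 → ℝ} (hφ : ContDiff ℝ ∞ φ) (hc : HasCompactSupport φ)
    (hs : tsupport φ ⊆ segSet U h) :
    ∫ x, φ x • (u (x + h) - u x) = ∫ x, φ x • ∫ t in Icc (0 : ℝ) 1, g (x + t • h) := by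
  have hfc : Continuous (fderiv ℝ φ) := hφ.continuous_fderiv (by simp)
  obtain ⟨C, hC⟩ := hφ.continuous.bounded_above_of_compact_support hc
  obtain ⟨C', hC'⟩ := hfc.bounded_above_of_compact_support (hc.fderiv ℝ)
  have hbd : ∀ (v : E3 → E3), Integrable v → ∀ a : E3, Integrable fun x => φ (x - a) • v x := by
    intro v hv a
    exact hv.bdd_smul (φ := fun x => φ (x - a)) C
      (hφ.continuous.comp (continuous_id.sub continuous_const)).aestronglyMeasurable
      (Filter.Eventually.of_forall fun x => hC _)
  have hleft : ∫ x, φ x • (u (x + h) - u x) = ∫ y, (φ (y - h) - φ y) • u y := by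
    have h1 : ∫ x, φ x • u (x + h) = ∫ y, φ (y - h) • u y := by
      have := integral_add_right_eq_self (μ := volume) (fun y => φ (y - h) • u y) h
      simpa using this
    have i0 : Integrable fun x => φ x • u x := by simpa using hbd u hu 0
    have i1 : Integrable fun x => φ x • u (x + h) := by
      have := (hbd u hu h).comp_add_right h
      simpa using this
    simp only [smul_sub, sub_smul]
    rw [integral_sub i1 i0, integral_sub (hbd u hu h) i0, h1]
  have hline : ∀ y, φ (y - h) - φ y = -∫ t in Icc (0 : ℝ) 1, fderiv ℝ φ (y - t • h) h := by
    intro y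
    have hd : ∀ t : ℝ, HasDerivAt (fun t : ℝ => φ (y - t • h)) (-(fderiv ℝ φ (y - t • h) h)) t := by
      intro t
      have h1 : HasDerivAt (fun t : ℝ => y - t • h) (-h) t := by
        simpa using ((hasDerivAt_id t).smul_const h).const_sub y
      have h2 := ((hφ.differentiable (by simp)) (y - t • h)).hasFDerivAt.comp_hasDerivAt t h1
      exact h2.congr_deriv (by simp)
    have hint := intervalIntegral.integral_eq_sub_of_hasDerivAt (a := 0) (b := 1)
      (fun t _ => hd t) (Continuous.intervalIntegrable (by fun_prop) _ _)
    rw [integral_Icc_eq_integral_Ioc, ← intervalIntegral.integral_of_le zero_le_one,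
      ← intervalIntegral.integral_neg, hint]
    simp
  have hA : Integrable (Function.uncurry fun (y : E3) (t : ℝ) => (fderiv ℝ φ (y - t • h) h) • u y)
      (volume.prod (volume.restrict (Icc (0 : ℝ) 1))) := by
    refine (hu.comp_fst (volume.restrict (Icc (0 : ℝ) 1))).bdd_smul
      (φ := fun p : E3 × ℝ => fderiv ℝ φ (p.1 - p.2 • h) h) (C' * ‖h‖) ?_ ?_
    · exact (Continuous.aestronglyMeasurable (by fun_prop))
    · refine Filter.Eventually.of_forall fun p => ?_
      exact (ContinuousLinearMap.le_opNorm _ _).trans (by gcongr; exact hC' _)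
  have hB : Integrable (Function.uncurry fun (t : ℝ) (x : E3) => φ x • g (x + t • h))
      ((volume.restrict (Icc (0 : ℝ) 1)).prod volume) := by
    have hgs : Integrable (fun p : ℝ × E3 => g (p.2 + p.1 • h))
        ((volume.restrict (Icc (0 : ℝ) 1)).prod volume) :=
      (measurePreserving_shear h).integrable_comp_of_integrable
        (hg.comp_snd (volume.restrict (Icc (0 : ℝ) 1)))
    exact hgs.bdd_smul (φ := fun p : ℝ × E3 => φ p.2) C
      (Continuous.aestronglyMeasurable (by fun_prop))
      (Filter.Eventually.of_forall fun p => hC _)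
  have hinner : ∀ t ∈ Icc (0 : ℝ) 1, ∫ y, (fderiv ℝ φ (y - t • h) h) • u y
      = -∫ x, φ x • g (x + t • h) := by
    intro t ht
    have hsh : ContDiff ℝ ∞ fun y => φ (y - t • h) := by fun_prop
    have hcs : HasCompactSupport fun y => φ (y - t • h) := by
      simpa [Function.comp_def, sub_eq_add_neg] using
        hc.comp_homeomorph (Homeomorph.addRight (-(t • h)))
    -- Translates stay admissible test functions because the support of `φ` lies in `segSet U h`.
    have hts : tsupport (fun y => φ (y - t • h)) ⊆ U := by
      intro y hy
      have hy' : y - t • h ∈ tsupport φ :=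
        tsupport_comp_subset_preimage φ (f := fun y => y - t • h) (by fun_prop) hy
      simpa using hs hy' t ht
    have := hw _ hsh hcs hts
    have hfd : ∀ y, fderiv ℝ (fun y => φ (y - t • h)) y = fderiv ℝ φ (y - t • h) := fun y =>
      fderiv_comp_sub (t • h)
    simp only [hfd] at this
    rw [this]
    have h1 := integral_add_right_eq_self (μ := volume) (fun y => φ (y - t • h) • g y) (t • h)
    simp only [add_sub_cancel_right] at h1
    rw [h1]
  calc ∫ x, φ x • (u (x + h) - u x)
      = ∫ y, (φ (y - h) - φ y) • u y := hleft
    _ = ∫ y, -∫ t in Icc (0 : ℝ) 1, (fderiv ℝ φ (y - t • h) h) • u y := by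
        congr 1; ext1 y
        rw [hline, integral_smul_const, neg_smul]
    _ = -∫ t in Icc (0 : ℝ) 1, ∫ y, (fderiv ℝ φ (y - t • h) h) • u y := by
        rw [integral_neg, integral_integral_swap hA]
    _ = ∫ t in Icc (0 : ℝ) 1, ∫ x, φ x • g (x + t • h) := by
        rw [← integral_neg]
        refine setIntegral_congr_fun measurableSet_Icc fun t ht => ?_
        simp only [hinner t ht, neg_neg]
    _ = ∫ x, ∫ t in Icc (0 : ℝ) 1, φ x • g (x + t • h) := integral_integral_swap hB
    _ = _ := by
        congr 1; ext1 x
        rw [integral_smul]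

/-- The energy `∫ |u (x + h) - u x|²` over the points whose segment to `x + h` lies in `U` is
controlled by the directional derivative along `h`. -/
lemma lintegral_segSet_sub_sq_le {U : Set E3} (hU : IsOpen U) {u g : E3 → E3} (hu : Integrable u)
    (hg : Integrable g) (hgm : Measurable g) (h : E3)
    (hw : ∀ φ : E3 → ℝ, ContDiff ℝ ∞ φ → HasCompactSupport φ → tsupport φ ⊆ U →
      ∫ x, (fderiv ℝ φ x h) • u x = -∫ x, φ x • g x) :
    ∫⁻ x in segSet U h, ‖u (x + h) - u x‖ₑ ^ 2 ≤ ∫⁻ x in U, ‖g x‖ₑ ^ 2 := by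
  have hso := isOpen_segSet hU h
  have hgs : Integrable (fun p : ℝ × E3 => g (p.2 + p.1 • h))
      ((volume.restrict (Icc (0 : ℝ) 1)).prod volume) :=
    (measurePreserving_shear h).integrable_comp_of_integrable
      (hg.comp_snd (volume.restrict (Icc (0 : ℝ) 1)))
  have hgi : Integrable fun x => ∫ t in Icc (0 : ℝ) 1, g (x + t • h) := hgs.integral_prod_right
  have hud : Integrable fun x => u (x + h) - u x := (hu.comp_add_right h).sub hu
  have hae : ∀ᵐ x, x ∈ segSet U h →
      (u (x + h) - u x) - ∫ t in Icc (0 : ℝ) 1, g (x + t • h) = 0 := by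
    -- Fundamental lemma of the calculus of variations: the tested identity becomes the fundamental
    -- theorem of calculus along almost every segment.
    refine hso.ae_eq_zero_of_integral_contDiff_smul_eq_zero
      ((hud.sub hgi).locallyIntegrable.locallyIntegrableOn _) ?_
    intro φ hφ hc hs
    obtain ⟨C, hC⟩ := hφ.continuous.bounded_above_of_compact_support hc
    have hbd : ∀ (v : E3 → E3), Integrable v → Integrable fun x => φ x • v x := fun v hv =>
      hv.bdd_smul (φ := φ) C hφ.continuous.aestronglyMeasurable
        (Filter.Eventually.of_forall hC)
    have := integral_smul_translate_sub hu hg h hw hφ hc hs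
    simp only [smul_sub _ (u _ - u _)]
    rw [integral_sub (hbd _ hud) (hbd _ hgi), this, sub_self]
  have hF : Measurable fun p : E3 × ℝ => ‖g (p.1 + p.2 • h)‖ₑ ^ 2 := by fun_prop
  calc ∫⁻ x in segSet U h, ‖u (x + h) - u x‖ₑ ^ 2
      ≤ ∫⁻ x in segSet U h, ∫⁻ t in Icc (0 : ℝ) 1, ‖g (x + t • h)‖ₑ ^ 2 := by
        refine lintegral_mono_ae ?_
        rw [ae_restrict_iff' hso.measurableSet]
        filter_upwards [hae] with x hx hxs
        rw [sub_eq_zero.1 (hx hxs)]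
        calc ‖∫ t in Icc (0 : ℝ) 1, g (x + t • h)‖ₑ ^ 2
            ≤ (∫⁻ t in Icc (0 : ℝ) 1, ‖g (x + t • h)‖ₑ) ^ 2 := by
              gcongr; exact enorm_integral_le_lintegral_enorm _
          _ ≤ _ := by
              refine (sq_lintegral_le _ (by fun_prop)).trans (le_of_eq ?_)
              simp
    _ = ∫⁻ t in Icc (0 : ℝ) 1, ∫⁻ x in segSet U h, ‖g (x + t • h)‖ₑ ^ 2 :=
        lintegral_lintegral_swap hF.aemeasurable
    _ ≤ ∫⁻ t in Icc (0 : ℝ) 1, ∫⁻ x in U, ‖g x‖ₑ ^ 2 := by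
        refine setLIntegral_mono' measurableSet_Icc fun t ht => ?_
        rw [← lintegral_indicator hso.measurableSet, ← lintegral_indicator hU.measurableSet,
          ← lintegral_add_right_eq_self (U.indicator fun x => ‖g x‖ₑ ^ 2) (t • h)]
        refine lintegral_mono fun x => ?_
        by_cases hx : x ∈ segSet U h
        · simp [hx, hx t ht]
        · simp [hx]
    _ = _ := by simp

lemma enorm_sum_smul_sq_le (h : E3) (v : Fin 3 → E3) :
    ‖∑ j, h j • v j‖ₑ ^ 2 ≤ ENNReal.ofReal (‖h‖ ^ 2) * ∑ j, ‖v j‖ₑ ^ 2 := by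
  have h1 : ‖∑ j, h j • v j‖ ^ 2 ≤ ‖h‖ ^ 2 * ∑ j, ‖v j‖ ^ 2 := by
    calc ‖∑ j, h j • v j‖ ^ 2 ≤ (∑ j, ‖h j‖ * ‖v j‖) ^ 2 := by
          gcongr
          exact (norm_sum_le _ _).trans (by simp [norm_smul])
      _ ≤ (∑ j, ‖h j‖ ^ 2) * ∑ j, ‖v j‖ ^ 2 := Finset.sum_mul_sq_le_sq_mul_sq _ _ _
      _ = _ := by rw [EuclideanSpace.norm_sq_eq]
  have h2 := ENNReal.ofReal_le_ofReal h1
  rw [ENNReal.ofReal_mul (by positivity), ENNReal.ofReal_sum_of_nonneg (by intros; positivity)] at h2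
  simpa [ENNReal.ofReal_pow] using h2

/-- The translation estimate for functions on `U` with weak partial derivatives `g j`. -/
lemma lintegral_segSet_sub_sq_le_of_weak_deriv {U : Set E3} (hU : IsOpen U) {u : E3 → E3}
    {g : Fin 3 → E3 → E3} (hu : Integrable u) (hg : ∀ j, Integrable (g j))
    (hgm : ∀ j, Measurable (g j))
    (hw : ∀ (j : Fin 3) (φ : E3 → ℝ), ContDiff ℝ ∞ φ → HasCompactSupport φ → tsupport φ ⊆ U →
      ∫ x, (fderiv ℝ φ x (EuclideanSpace.single j 1)) • u x = -∫ x, φ x • g j x) (h : E3) :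
    ∫⁻ x in segSet U h, ‖u (x + h) - u x‖ₑ ^ 2 ≤
      ENNReal.ofReal (‖h‖ ^ 2) * ∫⁻ x in U, ∑ j, ‖g j x‖ₑ ^ 2 := by
  have key := lintegral_segSet_sub_sq_le hU hu (g := fun x => ∑ j, h j • g j x)
    (integrable_finsetSum _ fun j _ => (hg j).smul (h j)) (by fun_prop) h ?_
  · refine key.trans ?_
    rw [← lintegral_const_mul _ (by fun_prop)]
    exact lintegral_mono fun x => enorm_sum_smul_sq_le h fun j => g j x
  · intro φ hφ hc hs
    obtain ⟨C, hC⟩ := hφ.continuous.bounded_above_of_compact_support hc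
    have hfc : Continuous (fderiv ℝ φ) := hφ.continuous_fderiv (by simp)
    obtain ⟨C', hC'⟩ := hfc.bounded_above_of_compact_support (hc.fderiv ℝ)
    have hh : h = ∑ j, h j • EuclideanSpace.single j (1 : ℝ) := by
      ext i; simp [Finset.sum_apply, Pi.single_apply]
    have hi1 : ∀ j, Integrable fun x => (fderiv ℝ φ x (EuclideanSpace.single j 1)) • u x := by
      intro j
      refine hu.bdd_smul (φ := fun x => fderiv ℝ φ x (EuclideanSpace.single j 1)) C'
        (Continuous.aestronglyMeasurable (by fun_prop)) (Filter.Eventually.of_forall fun x => ?_)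
      have := (fderiv ℝ φ x).le_opNorm (EuclideanSpace.single j 1)
      simp only [PiLp.norm_single, norm_one, mul_one] at this
      exact this.trans (hC' x)
    have hi2 : ∀ j, Integrable fun x => φ x • g j x := fun j =>
      (hg j).bdd_smul (φ := φ) C hφ.continuous.aestronglyMeasurable
        (Filter.Eventually.of_forall hC)
    calc ∫ x, (fderiv ℝ φ x h) • u x
        = ∫ x, ∑ j, h j • ((fderiv ℝ φ x (EuclideanSpace.single j 1)) • u x) := by
          congr 1; ext1 x
          conv_lhs => rw [hh]
          simp only [map_sum, map_smul, smul_eq_mul, Finset.sum_smul, mul_smul]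
      _ = ∑ j, h j • ∫ x, (fderiv ℝ φ x (EuclideanSpace.single j 1)) • u x := by
          rw [integral_finsetSum _ fun j _ => by exact (hi1 j).smul (h j)]
          simp only [integral_smul]
      _ = -∑ j, h j • ∫ x, φ x • g j x := by
          simp only [hw _ φ hφ hc hs, smul_neg, Finset.sum_neg_distrib]
      _ = _ := by
          simp only [← integral_smul]
          rw [← integral_finsetSum _ fun j _ => by exact (hi2 j).smul (h j)]
          congr 2; ext1 x
          simp only [Finset.smul_sum, smul_comm (φ x)]

/-! ### Poincaré inequality on a Lipschitz domain from translation bounds -/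

/-- Translates of `v` along segments contained in `Ω` are controlled by the energy `G`. -/
def TranslationBound (Ω : Set E3) (v : E3 → E3) (G : ℝ≥0∞) : Prop :=
  ∀ h : E3, ∫⁻ x in segSet Ω h, ‖v (x + h) - v x‖ₑ ^ 2 ≤ ENNReal.ofReal ((‖h‖ + 1) ^ 2) * G

lemma enorm_sum_sq_le {ι : Type*} (s : Finset ι) (a : ι → E3) :
    ‖∑ i ∈ s, a i‖ₑ ^ 2 ≤ s.card * ∑ i ∈ s, ‖a i‖ₑ ^ 2 := by
  have h1 : ‖∑ i ∈ s, a i‖ ^ 2 ≤ s.card * ∑ i ∈ s, ‖a i‖ ^ 2 :=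
    (pow_le_pow_left₀ (norm_nonneg _) (norm_sum_le _ _) 2).trans sq_sum_le_card_mul_sum_sq
  have h2 := ENNReal.ofReal_le_ofReal h1
  rw [ENNReal.ofReal_mul (by positivity), ENNReal.ofReal_sum_of_nonneg (by intros; positivity)] at h2
  simpa [ENNReal.ofReal_pow] using h2

lemma enorm_sub_sq_le (a b c : E3) : ‖a - c‖ₑ ^ 2 ≤ 2 * ‖a - b‖ₑ ^ 2 + 2 * ‖b - c‖ₑ ^ 2 := by
  have := enorm_sum_sq_le Finset.univ ![a - b, b - c]
  simpa [Fin.sum_univ_two, mul_add] using this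

/-- A bound for translations by at most `ε` yields, by subdividing, one for all translations. -/
lemma TranslationBound.of_small {Ω : Set E3} (hΩ : IsOpen Ω) {v : E3 → E3} (hv : Measurable v)
    {G : ℝ≥0∞} {ε : ℝ} (hε : 0 < ε) (hε1 : ε ≤ 1)
    (H : ∀ h : E3, ‖h‖ ≤ ε →
      ∫⁻ x in segSet Ω h, ‖v (x + h) - v x‖ₑ ^ 2 ≤ ENNReal.ofReal (ε ^ 2) * G) :
    TranslationBound Ω v G := by
  intro h
  -- Each of `n` steps costs `ε ^ 2`, whatever its length, and squaring a sum of `n` increments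
  -- costs `n ^ 2` in total. Since `n * ε ≤ ‖h‖ + ε`, the `+ 1` in `TranslationBound` absorbs the
  -- rounding.
  set n : ℕ := ⌊‖h‖ / ε⌋₊ + 1 with hn
  have hn0 : (0 : ℝ) < n := by positivity
  have hn1 : ‖h‖ / ε ≤ n := by rw [hn]; push_cast; exact (Nat.lt_floor_add_one _).le
  have hn2 : (n : ℝ) * ε ≤ ‖h‖ + 1 := by
    have : (⌊‖h‖ / ε⌋₊ : ℝ) ≤ ‖h‖ / ε := Nat.floor_le (by positivity)
    rw [hn]; push_cast
    calc ((⌊‖h‖ / ε⌋₊ : ℝ) + 1) * ε ≤ (‖h‖ / ε + 1) * ε := by gcongr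
      _ = ‖h‖ + ε := by field_simp
      _ ≤ _ := by gcongr
  set k : E3 := (n : ℝ)⁻¹ • h with hk
  have hkε : ‖k‖ ≤ ε := by
    rw [hk, norm_smul, norm_inv, Real.norm_natCast, inv_mul_le_iff₀ hn0]
    rwa [div_le_iff₀ hε] at hn1
  have hnk : (n : ℝ) • k = h := by rw [hk, smul_inv_smul₀ hn0.ne']
  have hterm : ∀ i ∈ Finset.range n, ∫⁻ x in segSet Ω h,
      ‖v (x + (i + 1 : ℝ) • k) - v (x + (i : ℝ) • k)‖ₑ ^ 2 ≤ ENNReal.ofReal (ε ^ 2) * G := by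
    intro i hi
    have hin : (i : ℝ) + 1 ≤ n := by exact_mod_cast Finset.mem_range.1 hi
    refine le_trans ?_ (H k hkε)
    have hm1 := (isOpen_segSet hΩ h).measurableSet
    have hm2 := (isOpen_segSet hΩ k).measurableSet
    rw [← lintegral_indicator hm1, ← lintegral_indicator hm2,
      ← lintegral_add_right_eq_self ((segSet Ω k).indicator fun x => ‖v (x + k) - v x‖ₑ ^ 2)
        ((i : ℝ) • k)]
    refine lintegral_mono fun x => ?_
    by_cases hx : x ∈ segSet Ω h
    · have hx' : x + (i : ℝ) • k ∈ segSet Ω k := by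
        intro t ht
        have := hx ((i + t) / n) ⟨by have := ht.1; positivity, by
          rw [div_le_one hn0]; linarith [ht.2]⟩
        rw [add_assoc, ← add_smul]
        rwa [← hnk, smul_smul, div_mul_cancel₀ _ hn0.ne'] at this
      simp only [hx, hx', indicator_of_mem]
      rw [add_assoc, add_smul, one_smul]
    · simp [hx]
  calc ∫⁻ x in segSet Ω h, ‖v (x + h) - v x‖ₑ ^ 2
      ≤ ∫⁻ x in segSet Ω h, n * ∑ i ∈ Finset.range n,
          ‖v (x + (i + 1 : ℝ) • k) - v (x + (i : ℝ) • k)‖ₑ ^ 2 := by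
        refine lintegral_mono fun x => ?_
        have h1 := enorm_sum_sq_le (Finset.range n)
          fun i => v (x + (i + 1 : ℝ) • k) - v (x + (i : ℝ) • k)
        have h2 := Finset.sum_range_sub (fun i : ℕ => v (x + (i : ℝ) • k)) n
        push_cast at h2
        rw [h2] at h1
        simpa [hnk] using h1
    _ = n * ∑ i ∈ Finset.range n, ∫⁻ x in segSet Ω h,
          ‖v (x + (i + 1 : ℝ) • k) - v (x + (i : ℝ) • k)‖ₑ ^ 2 := by
        rw [lintegral_const_mul _ (by fun_prop), lintegral_finsetSum _ (by fun_prop)]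
    _ ≤ n * ∑ i ∈ Finset.range n, ENNReal.ofReal (ε ^ 2) * G := by
        gcongr with i hi; exact hterm i hi
    _ = ENNReal.ofReal ((n * ε) ^ 2) * G := by
        rw [Finset.sum_const, Finset.card_range, nsmul_eq_mul, mul_pow,
          ENNReal.ofReal_mul (by positivity), ENNReal.ofReal_pow hn0.le,
          ENNReal.ofReal_natCast]
        ring
    _ ≤ _ := by gcongr

/-- The mean-square oscillation of `v` between `A` and `B` is controlled by the energy, for every
`v` satisfying a translation bound on `Ω`. -/
def Linked (Ω A B : Set E3) : Prop :=
  ∃ C : ℝ≥0∞, C ≠ ⊤ ∧ ∀ v : E3 → E3, Measurable v → ∀ G, TranslationBound Ω v G →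
    ∫⁻ x in A, ∫⁻ y in B, ‖v x - v y‖ₑ ^ 2 ≤ C * G

lemma Linked.mono {Ω A A' B B' : Set E3} (h : Linked Ω A B) (hA : A' ⊆ A) (hB : B' ⊆ B) :
    Linked Ω A' B' := by
  obtain ⟨C, hC, H⟩ := h
  refine ⟨C, hC, fun v hv G hG => le_trans ?_ (H v hv G hG)⟩
  exact (lintegral_mono fun x => lintegral_mono_set hB).trans (lintegral_mono_set hA)

lemma linked_empty (Ω B : Set E3) : Linked Ω ∅ B := ⟨0, by simp, fun v _ G _ => by simp⟩

lemma Linked.union {Ω A A' B : Set E3} (h : Linked Ω A B) (h' : Linked Ω A' B) :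
    Linked Ω (A ∪ A') B := by
  obtain ⟨C, hC, H⟩ := h
  obtain ⟨C', hC', H'⟩ := h'
  refine ⟨C + C', ENNReal.add_ne_top.2 ⟨hC, hC'⟩, fun v hv G hG => ?_⟩
  rw [add_mul]
  exact (lintegral_union_le _ A A').trans (add_le_add (H v hv G hG) (H' v hv G hG))

lemma measurable_lintegral_sub_sq {v : E3 → E3} (hv : Measurable v) (B : Set E3) :
    Measurable fun x => ∫⁻ y in B, ‖v x - v y‖ₑ ^ 2 := by
  have : Measurable fun p : E3 × E3 => ‖v p.1 - v p.2‖ₑ ^ 2 := by fun_prop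
  exact this.lintegral_prod_right'

/-- Insert an intermediate value `v z`, integrate over `z ∈ B₁`, and divide by the positive finite
volume of `B₁`. -/
lemma Linked.trans {Ω A B₁ B : Set E3} (h : Linked Ω A B₁) (h' : Linked Ω B₁ B)
    (hB₁ : volume B₁ ≠ 0) (hB₁' : volume B₁ ≠ ⊤) (hA : volume A ≠ ⊤) (hB : volume B ≠ ⊤) :
    Linked Ω A B := by
  obtain ⟨C, hC, H⟩ := h
  obtain ⟨C', hC', H'⟩ := h'
  refine ⟨(volume B₁)⁻¹ * (2 * volume B * C + 2 * volume A * C'), ?_, fun v hv G hG => ?_⟩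
  · finiteness
  have hm := measurable_lintegral_sub_sq hv
  have key : volume B₁ * ∫⁻ x in A, ∫⁻ y in B, ‖v x - v y‖ₑ ^ 2 ≤
      (2 * volume B * C + 2 * volume A * C') * G := by
    calc volume B₁ * ∫⁻ x in A, ∫⁻ y in B, ‖v x - v y‖ₑ ^ 2
        = ∫⁻ x in A, ∫⁻ y in B, ∫⁻ z in B₁, ‖v x - v y‖ₑ ^ 2 := by
          rw [← lintegral_const_mul _ (hm B)]
          congr 1; ext1 x
          rw [← lintegral_const_mul _ (by fun_prop)]
          simp [mul_comm]
      _ ≤ ∫⁻ x in A, ∫⁻ y in B, ∫⁻ z in B₁, (2 * ‖v x - v z‖ₑ ^ 2 + 2 * ‖v z - v y‖ₑ ^ 2) := by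
          gcongr; exact enorm_sub_sq_le _ _ _
      _ = 2 * volume B * (∫⁻ x in A, ∫⁻ z in B₁, ‖v x - v z‖ₑ ^ 2) +
          2 * volume A * ∫⁻ z in B₁, ∫⁻ y in B, ‖v z - v y‖ₑ ^ 2 := by
          have hF : Measurable fun p : E3 × E3 => ‖v p.2 - v p.1‖ₑ ^ 2 := by fun_prop
          have hF' : Measurable fun y => ∫⁻ z in B₁, ‖v z - v y‖ₑ ^ 2 := hF.lintegral_prod_right'
          have hsw : ∫⁻ y in B, ∫⁻ z in B₁, ‖v z - v y‖ₑ ^ 2 =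
              ∫⁻ z in B₁, ∫⁻ y in B, ‖v z - v y‖ₑ ^ 2 := lintegral_lintegral_swap hF.aemeasurable
          have hin : ∀ x, ∫⁻ y in B, ∫⁻ z in B₁, (2 * ‖v x - v z‖ₑ ^ 2 + 2 * ‖v z - v y‖ₑ ^ 2) =
              2 * volume B * (∫⁻ z in B₁, ‖v x - v z‖ₑ ^ 2) +
              2 * ∫⁻ z in B₁, ∫⁻ y in B, ‖v z - v y‖ₑ ^ 2 := by
            intro x
            have : ∀ y, ∫⁻ z in B₁, (2 * ‖v x - v z‖ₑ ^ 2 + 2 * ‖v z - v y‖ₑ ^ 2) =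
                2 * (∫⁻ z in B₁, ‖v x - v z‖ₑ ^ 2) + 2 * ∫⁻ z in B₁, ‖v z - v y‖ₑ ^ 2 := by
              intro y
              rw [lintegral_add_left (by fun_prop), lintegral_const_mul _ (by fun_prop),
                lintegral_const_mul _ (by fun_prop)]
            simp only [this]
            rw [lintegral_add_left (by fun_prop), lintegral_const_mul _ hF', hsw]
            simp; ring
          simp only [hin]
          rw [lintegral_add_left ((hm B₁).const_mul _), lintegral_const_mul _ (hm B₁)]
          simp; ring
      _ ≤ 2 * volume B * (C * G) + 2 * volume A * (C' * G) := by
          gcongr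
          · exact H v hv G hG
          · exact H' v hv G hG
      _ = _ := by ring
  calc ∫⁻ x in A, ∫⁻ y in B, ‖v x - v y‖ₑ ^ 2
      = (volume B₁)⁻¹ * (volume B₁ * ∫⁻ x in A, ∫⁻ y in B, ‖v x - v y‖ₑ ^ 2) := by
        rw [← mul_assoc, ENNReal.inv_mul_cancel hB₁ hB₁', one_mul]
    _ ≤ (volume B₁)⁻¹ * ((2 * volume B * C + 2 * volume A * C') * G) := by gcongr
    _ = _ := by ring

/-- Substituting `z = y + h` and exchanging integrals turns the double integral into an integral of
translation energies over `‖h‖ < 2 r`; convexity keeps the segments in `Ω`. -/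
lemma linked_ball_self {Ω : Set E3} (hΩ : IsOpen Ω) {x : E3} {r : ℝ}
    (hB : Metric.ball x r ⊆ Ω) : Linked Ω (Metric.ball x r) (Metric.ball x r) := by
  refine ⟨volume (Metric.ball (0 : E3) (2 * r)) * ENNReal.ofReal ((2 * r + 1) ^ 2), ?_, ?_⟩
  · exact ENNReal.mul_ne_top measure_ball_lt_top.ne ENNReal.ofReal_ne_top
  intro v hv G hG
  set B := Metric.ball x r with hBdef
  have hBm : MeasurableSet B := Metric.isOpen_ball.measurableSet
  have hF : Measurable (Function.uncurry fun (y h : E3) =>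
      (segSet Ω h ∩ B).indicator (fun y => B.indicator (fun _ => ‖v (y + h) - v y‖ₑ ^ 2) (y + h)) y) := by
    have : (Function.uncurry fun (y h : E3) =>
      (segSet Ω h ∩ B).indicator (fun y => B.indicator (fun _ => ‖v (y + h) - v y‖ₑ ^ 2) (y + h)) y)
      = {p : E3 × E3 | p.1 ∈ B ∧ p.1 + p.2 ∈ B}.indicator
          fun p => ‖v (p.1 + p.2) - v p.1‖ₑ ^ 2 := by
      ext ⟨y, h⟩
      by_cases h1 : y ∈ B <;> by_cases h2 : y + h ∈ B
      · have h3 : y ∈ segSet Ω h := fun t ht => hB <| by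
          have := (convex_ball x r) h1 h2 (sub_nonneg.2 ht.2) ht.1 (by ring)
          convert this using 1
          module
        simp [h1, h2, h3]
      all_goals simp [h1, h2, indicator]
    rw [this]
    refine Measurable.indicator (by fun_prop) ?_
    exact (hBm.preimage measurable_fst).inter
      (hBm.preimage (measurable_fst.add measurable_snd))
  calc ∫⁻ y in B, ∫⁻ z in B, ‖v y - v z‖ₑ ^ 2
      = ∫⁻ y, ∫⁻ h, (segSet Ω h ∩ B).indicator
          (fun y => B.indicator (fun _ => ‖v (y + h) - v y‖ₑ ^ 2) (y + h)) y := by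
        rw [← lintegral_indicator hBm]
        congr 1; ext1 y
        by_cases hy : y ∈ B
        · rw [indicator_of_mem hy, ← lintegral_indicator hBm,
            ← lintegral_add_left_eq_self _ y]
          congr 1; ext1 h
          by_cases h2 : y + h ∈ B
          · have h3 : y ∈ segSet Ω h := fun t ht => hB <| by
              have := (convex_ball x r) hy h2 (sub_nonneg.2 ht.2) ht.1 (by ring)
              convert this using 1
              module
            have h4 : y ∈ segSet Ω h ∩ B := ⟨h3, hy⟩
            rw [indicator_of_mem h2, indicator_of_mem h4, indicator_of_mem h2, ← enorm_neg, neg_sub]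
          · simp [h2, indicator]
        · simp [hy]
    _ = ∫⁻ h, ∫⁻ y, (segSet Ω h ∩ B).indicator
          (fun y => B.indicator (fun _ => ‖v (y + h) - v y‖ₑ ^ 2) (y + h)) y :=
        lintegral_lintegral_swap hF.aemeasurable
    _ ≤ ∫⁻ h, (Metric.ball (0 : E3) (2 * r)).indicator
          (fun _ => ENNReal.ofReal ((2 * r + 1) ^ 2) * G) h := by
        refine lintegral_mono fun h => ?_
        by_cases hh : h ∈ Metric.ball (0 : E3) (2 * r)
        · rw [indicator_of_mem hh]
          have hle := hG h
          rw [mem_ball_zero_iff] at hh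
          refine le_trans ?_ (hle.trans (by gcongr))
          rw [← lintegral_indicator (isOpen_segSet hΩ h).measurableSet]
          refine lintegral_mono fun y => ?_
          by_cases h1 : y ∈ segSet Ω h <;> by_cases h2 : y ∈ B <;> by_cases h3 : y + h ∈ B <;>
            simp [h1, h2, h3]
        · rw [indicator_of_notMem hh]
          refine (lintegral_eq_zero_of_ae_eq_zero (Filter.Eventually.of_forall fun y => ?_)).le
          by_cases h2 : y ∈ B <;> by_cases h3 : y + h ∈ B
          · refine absurd ?_ hh
            rw [mem_ball_zero_iff]
            rw [hBdef, mem_ball_iff_norm] at h2 h3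
            calc ‖h‖ = ‖(y + h - x) - (y - x)‖ := by congr 1; abel
              _ ≤ ‖y + h - x‖ + ‖y - x‖ := norm_sub_le _ _
              _ < _ := by linarith
          all_goals simp [h2, h3, indicator]
    _ = _ := by
        rw [lintegral_indicator Metric.isOpen_ball.measurableSet]
        simp; ring

/-- A set inherits a link from the set it is carried into, at the price of one translation energy.
This is how boundary pieces are reached from interior balls. -/
lemma Linked.translate {Ω V B₁ B : Set E3} {h : E3} (hV : V ⊆ segSet Ω h)
    (hVB : ∀ x ∈ V, x + h ∈ B₁) (hVm : MeasurableSet V) (hB₁m : MeasurableSet B₁)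
    (hL : Linked Ω B₁ B) (hB : volume B ≠ ⊤) : Linked Ω V B := by
  obtain ⟨C, hC, H⟩ := hL
  refine ⟨2 * volume B * ENNReal.ofReal ((‖h‖ + 1) ^ 2) + 2 * C, ?_, fun v hv G hG => ?_⟩
  · finiteness
  have hm := measurable_lintegral_sub_sq hv B
  calc ∫⁻ x in V, ∫⁻ y in B, ‖v x - v y‖ₑ ^ 2
      ≤ ∫⁻ x in V, ∫⁻ y in B, (2 * ‖v (x + h) - v x‖ₑ ^ 2 + 2 * ‖v (x + h) - v y‖ₑ ^ 2) := by
        gcongr with x y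
        have := enorm_sub_sq_le (v x) (v (x + h)) (v y)
        rwa [← enorm_neg (v x - v (x + h)), neg_sub] at this
    _ = 2 * volume B * (∫⁻ x in V, ‖v (x + h) - v x‖ₑ ^ 2) +
          2 * ∫⁻ x in V, ∫⁻ y in B, ‖v (x + h) - v y‖ₑ ^ 2 := by
        have : ∀ x, ∫⁻ y in B, (2 * ‖v (x + h) - v x‖ₑ ^ 2 + 2 * ‖v (x + h) - v y‖ₑ ^ 2) =
            2 * volume B * ‖v (x + h) - v x‖ₑ ^ 2 + 2 * ∫⁻ y in B, ‖v (x + h) - v y‖ₑ ^ 2 := by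
          intro x
          rw [lintegral_add_left (by fun_prop), lintegral_const,
            lintegral_const_mul 2 (f := fun y => ‖v (x + h) - v y‖ₑ ^ 2) (by fun_prop)]
          simp; ring
        simp only [this]
        rw [lintegral_add_left (by fun_prop), lintegral_const_mul _ (by fun_prop),
          lintegral_const_mul _ (by exact hm.comp (measurable_add_const h))]
    _ ≤ 2 * volume B * (ENNReal.ofReal ((‖h‖ + 1) ^ 2) * G) + 2 * (C * G) := by
        gcongr
        · exact (lintegral_mono_set hV).trans (hG h)
        · refine le_trans ?_ (H v hv G hG)
          rw [← lintegral_indicator hVm, ← lintegral_indicator hB₁m,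
            ← lintegral_add_right_eq_self
              (B₁.indicator fun x => ∫⁻ y in B, ‖v x - v y‖ₑ ^ 2) h]
          refine lintegral_mono fun x => ?_
          by_cases hx : x ∈ V
          · simp [hx, hVB x hx]
          · simp [hx]
    _ = _ := by ring

/-- Connectedness argument: the points having a linked ball form an open set that is relatively
closed in `Ω`, since a ball around a limit point overlaps a linked one. -/
lemma exists_linked_ball {Ω : Set E3} (hΩ : IsOpen Ω) (hc : IsPreconnected Ω) {x₀ : E3} {r₀ : ℝ}
    (hr₀ : 0 < r₀) (hB : Metric.ball x₀ r₀ ⊆ Ω) {x : E3} (hx : x ∈ Ω) :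
    ∃ r > 0, Linked Ω (Metric.ball x r) (Metric.ball x₀ r₀) := by
  set W : Set E3 := {x | ∃ r > 0, Linked Ω (Metric.ball x r) (Metric.ball x₀ r₀)} with hW
  have hopen : IsOpen W := by
    rw [Metric.isOpen_iff]
    rintro y ⟨r, hr, hL⟩
    refine ⟨r, hr, fun z hz => ⟨r - dist z y, sub_pos.2 hz, hL.mono ?_ subset_rfl⟩⟩
    exact Metric.ball_subset_ball' (by linarith)
  have hx₀ : x₀ ∈ Ω := hB (Metric.mem_ball_self hr₀)
  refine hc.subset_of_closure_inter_subset hopen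
    ⟨x₀, hx₀, r₀, hr₀, linked_ball_self hΩ hB⟩ ?_ hx
  rintro y ⟨hy, hyΩ⟩
  obtain ⟨r, hr, hrΩ⟩ := Metric.isOpen_iff.1 hΩ y hyΩ
  obtain ⟨z, ⟨s, hs, hL⟩, hyz⟩ := Metric.mem_closure_iff.1 hy r hr
  rw [dist_comm] at hyz
  refine ⟨r, hr, ?_⟩
  have hm : 0 < min s (r - dist z y) := lt_min hs (sub_pos.2 hyz)
  have h1 : Linked Ω (Metric.ball y r) (Metric.ball z (min s (r - dist z y))) := by
    refine (linked_ball_self hΩ hrΩ).mono subset_rfl (Metric.ball_subset_ball' ?_)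
    linarith [min_le_right s (r - dist z y)]
  refine h1.trans (hL.mono (Metric.ball_subset_ball (min_le_left _ _)) subset_rfl)
    (Metric.measure_ball_pos _ _ hm).ne' measure_ball_lt_top.ne measure_ball_lt_top.ne
    measure_ball_lt_top.ne

/-- Moving along the vertical axis `e` of the graph stays above the graph, so a boundary piece is
carried into a ball around the interior point `p + r • e`. -/
lemma exists_linked_nhds_of_mem_frontier {Ω : Set E3} (hΩ : IsBoundedLipschitzDomain Ω)
    {B : Set E3} (hBt : volume B ≠ ⊤)
    (hB : ∀ x ∈ Ω, ∃ r > 0, Linked Ω (Metric.ball x r) B) {p : E3} (hp : p ∈ frontier Ω) :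
    ∃ r > 0, Linked Ω (Metric.ball p r ∩ Ω) B := by
  obtain ⟨U, hU, hpU, A, K, h, hh, hUΩ⟩ := hΩ.lipschitz_boundary p hp
  obtain ⟨R, hR, hRU⟩ := Metric.isOpen_iff.1 hU p hpU
  -- Half of `R`, so that a point within `r` of `p`, moved by at most `r`, is still in `U`.
  set r := R / 2 with hr
  have hr0 : 0 < r := by positivity
  set e : E3 := A.symm (EuclideanSpace.single 2 1) with he
  have hAe : ∀ (x : E3) (t : ℝ), A (x + t • e) = A x + t • EuclideanSpace.single 2 1 := by
    intro x t; simp [he]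
  have hA0 : ∀ (x : E3) (t : ℝ), A (x + t • e) 0 = A x 0 := by intro x t; rw [hAe]; simp
  have hA1 : ∀ (x : E3) (t : ℝ), A (x + t • e) 1 = A x 1 := by intro x t; rw [hAe]; simp
  have hA2 : ∀ (x : E3) (t : ℝ), A (x + t • e) 2 = A x 2 + t := by intro x t; rw [hAe]; simp
  have hen : ‖e‖ = 1 := by simp [he]
  have hcont : Continuous fun x : E3 => h !₂[A x 0, A x 1] := by
    refine hh.continuous.comp ?_
    have := A.continuous
    fun_prop
  -- Below the graph, a whole neighbourhood of `p` would miss `Ω`.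
  have hp2 : h !₂[A p 0, A p 1] ≤ A p 2 := by
    by_contra hcon
    push Not at hcon
    have hcA : Continuous fun x : E3 => A x 2 := by
      have := A.continuous
      fun_prop
    have hopen : IsOpen (U ∩ {x : E3 | A x 2 < h !₂[A x 0, A x 1]}) :=
      hU.inter (isOpen_lt hcA hcont)
    obtain ⟨y, ⟨hyU, hy⟩, hyΩ⟩ := mem_closure_iff.1 (frontier_subset_closure hp) _ hopen
      ⟨hpU, hcon⟩
    exact absurd ((hUΩ y hyU).1 hyΩ) (not_lt.2 (le_of_lt hy))
  have hq : p + r • e ∈ Ω := by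
    refine (hUΩ _ (hRU ?_)).2 ?_
    · rw [mem_ball_iff_norm]; simp [norm_smul, hen, abs_of_pos hr0]; linarith
    · rw [hA0, hA1, hA2]; linarith
  obtain ⟨s, hs, hL⟩ := hB _ hq
  refine ⟨min s r, lt_min hs hr0, ?_⟩
  refine Linked.translate (h := r • e) (B₁ := Metric.ball (p + r • e) s) ?_ ?_
    (Metric.isOpen_ball.inter hΩ.isOpen).measurableSet Metric.isOpen_ball.measurableSet hL hBt
  · rintro x ⟨hx, hxΩ⟩ t ht
    have hxr : dist x p < r := lt_of_lt_of_le hx (min_le_right _ _)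
    have hxU : x ∈ U := hRU (by rw [Metric.mem_ball]; linarith)
    rw [smul_smul]
    have htr : 0 ≤ t * r := mul_nonneg ht.1 hr0.le
    have htr' : t * r ≤ r := mul_le_of_le_one_left hr0.le ht.2
    refine (hUΩ _ (hRU ?_)).2 ?_
    · rw [Metric.mem_ball]
      have h1 : dist (x + (t * r) • e) x ≤ r := by
        rw [dist_eq_norm, add_sub_cancel_left, norm_smul, hen, mul_one, Real.norm_of_nonneg htr]
        exact htr'
      linarith [dist_triangle (x + (t * r) • e) x p]
    · rw [hA0, hA1, hA2]; linarith [(hUΩ x hxU).1 hxΩ]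
  · rintro x ⟨hx, -⟩
    rw [Metric.mem_ball, dist_add_right]
    exact lt_of_lt_of_le hx (min_le_left _ _)

/-- The Poincaré inequality on a bounded Lipschitz domain, for functions satisfying a translation
bound. -/
lemma exists_linked_self_ball {Ω : Set E3} (hΩ : IsBoundedLipschitzDomain Ω) :
    ∃ (x₀ : E3) (r₀ : ℝ), 0 < r₀ ∧ Metric.ball x₀ r₀ ⊆ Ω ∧ Linked Ω Ω (Metric.ball x₀ r₀) := by
  obtain ⟨x₀, hx₀⟩ := hΩ.isConnected.nonempty
  obtain ⟨r₀, hr₀, hB⟩ := Metric.isOpen_iff.1 hΩ.isOpen x₀ hx₀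
  refine ⟨x₀, r₀, hr₀, hB, ?_⟩
  have hint : ∀ x ∈ Ω, ∃ r > 0, Linked Ω (Metric.ball x r) (Metric.ball x₀ r₀) := fun x hx =>
    exists_linked_ball hΩ.isOpen hΩ.isConnected.isPreconnected hr₀ hB hx
  have hcpt : IsCompact (closure Ω) := hΩ.isBounded.isCompact_closure
  have key : Linked Ω (closure Ω ∩ Ω) (Metric.ball x₀ r₀) := by
    refine hcpt.induction_on (p := fun s => Linked Ω (s ∩ Ω) (Metric.ball x₀ r₀)) ?_ ?_ ?_ ?_
    · simpa using linked_empty Ω _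
    · exact fun s t hst ht => ht.mono (inter_subset_inter_left _ hst) subset_rfl
    · intro s t hs ht
      rw [union_inter_distrib_right]
      exact hs.union ht
    · intro x hx
      by_cases hxΩ : x ∈ Ω
      · obtain ⟨r, hr, hL⟩ := hint x hxΩ
        exact ⟨_, mem_nhdsWithin_of_mem_nhds (Metric.ball_mem_nhds x hr),
          hL.mono inter_subset_left subset_rfl⟩
      · have hfr : x ∈ frontier Ω := ⟨hx, by rwa [hΩ.isOpen.interior_eq]⟩
        obtain ⟨r, hr, hL⟩ := exists_linked_nhds_of_mem_frontier hΩ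
          measure_ball_lt_top.ne hint hfr
        exact ⟨_, mem_nhdsWithin_of_mem_nhds (Metric.ball_mem_nhds x hr), hL⟩
  rwa [inter_eq_right.2 subset_closure] at key

/-! ### Geometry of the curve at scale `ε` -/

/-- A compact set `Γ` with a tangent direction at each of its points: differences to the points
whose nearest point is `y` are orthogonal to the direction at `y`, and `Γ` does not enter the open
balls of radius `ρ / 2` which touch that direction at `y`. -/
structure HasTangentBalls (Γ : Set E3) (ρ : ℝ) : Prop where
  isCompact : IsCompact Γ
  nonempty : Γ.Nonempty
  tangent : ∀ y ∈ Γ, ∃ τ : E3, (∀ x, (∀ z ∈ Γ, dist x y ≤ dist x z) → inner ℝ (x - y) τ = 0) ∧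
    ∀ ν : E3, ‖ν‖ = 1 → inner ℝ ν τ = 0 → ∀ z ∈ Γ, inner ℝ (z - y) ν ≤ ‖z - y‖ ^ 2 / ρ

lemma IsNormalFrame.exists_eq_of_inner_eq_zero {γ : ℝ → E3} {L : ℝ} {n₁ n₂ : ℝ → E3}
    (hF : IsNormalFrame γ L n₁ n₂) {s : ℝ} {q : E3}
    (hq : inner ℝ q (deriv γ s) = 0) :
    ∃ w : E2, q = w 0 • n₁ s + w 1 • n₂ s ∧ ‖w‖ = ‖q‖ := by
  have ho := hF.orthonormal s
  have hsp : ⊤ ≤ Submodule.span ℝ (range ![unitTangent γ s, n₁ s, n₂ s]) :=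
    (ho.linearIndependent.span_eq_top_of_card_eq_finrank (by simp)).ge
  set b := OrthonormalBasis.mk ho hsp with hb
  have h0 : inner ℝ (unitTangent γ s) q = 0 := by
    rw [unitTangent, inner_smul_left, real_inner_comm, hq, mul_zero]
  have hsum := b.sum_repr' q
  have hnorm := b.sum_sq_norm_inner_right q
  rw [Fin.sum_univ_three] at hsum hnorm
  simp only [hb, OrthonormalBasis.coe_mk, Matrix.cons_val_zero, Matrix.cons_val_one,
    Matrix.cons_val_two, Matrix.head_cons, Matrix.tail_cons, h0, zero_smul, zero_add,
    norm_zero] at hsum hnorm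
  refine ⟨!₂[inner ℝ (n₁ s) q, inner ℝ (n₂ s) q], by simpa using hsum.symm, ?_⟩
  have : ‖(!₂[inner ℝ (n₁ s) q, inner ℝ (n₂ s) q] : E2)‖ ^ 2 = ‖q‖ ^ 2 := by
    rw [EuclideanSpace.norm_sq_eq, ← hnorm]; simp [Fin.sum_univ_two]
  exact (pow_left_inj₀ (norm_nonneg _) (norm_nonneg _) two_ne_zero).1 this

lemma inner_deriv_eq_zero_of_nearest {γ : ℝ → E3} {s : ℝ} (hd : DifferentiableAt ℝ γ s) {x : E3}
    (h : ∀ s', dist x (γ s) ≤ dist x (γ s')) : inner ℝ (x - γ s) (deriv γ s) = 0 := by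
  have h1 : HasDerivAt (fun s => x - γ s) (-(deriv γ s)) s := hd.hasDerivAt.const_sub x
  have h2 := h1.norm_sq
  have hmin : IsLocalMin (fun s => ‖x - γ s‖ ^ 2) s := by
    refine Filter.Eventually.of_forall fun s' => ?_
    have := h s'
    rw [dist_eq_norm, dist_eq_norm] at this
    dsimp only
    gcongr
  have h3 := hmin.hasDerivAt_eq_zero h2
  rw [inner_neg_right] at h3
  linarith

/-- If the curve entered a touching ball, its centre `p` would have a nearest curve point closer
than `ρ / 2`. Then `p` would have two different normal coordinates in the tube, one of length `ρ /
2` and one shorter, against injectivity. -/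
lemma IsEmbeddedClosedCurve.hasTangentBalls {γ : ℝ → E3} {L ρ : ℝ}
    (hγ : IsEmbeddedClosedCurve γ L) (hρ : 0 < ρ)
    (h : ENNReal.ofReal ρ ≤ embeddednessRadius γ L) : HasTangentBalls (range γ) ρ := by
  have hlt : ENNReal.ofReal (ρ / 2) < embeddednessRadius γ L :=
    lt_of_lt_of_le ((ENNReal.ofReal_lt_ofReal_iff hρ).2 (by linarith)) h
  obtain ⟨R, ⟨r, hr, rfl, n₁, n₂, hF, hinj, -⟩, hρr⟩ := lt_sSup_iff.1 hlt
  have hρr : ρ / 2 < r := (ENNReal.ofReal_lt_ofReal_iff hr).1 hρr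
  have hcpt : IsCompact (range γ) :=
    hγ.periodic.compact_of_continuous hγ.period_pos.ne' hγ.contDiff.continuous
  have hdiff : Differentiable ℝ γ := hγ.contDiff.differentiable (by simp)
  refine ⟨hcpt, range_nonempty γ, ?_⟩
  rintro _ ⟨s₁, rfl⟩
  obtain ⟨s, hs, hss⟩ := hγ.periodic.exists_mem_Ico₀ hγ.period_pos s₁
  rw [hss]
  refine ⟨deriv γ s, fun x hx => inner_deriv_eq_zero_of_nearest (hdiff s)
    fun s' => hx _ (mem_range_self s'), fun ν hν hντ z hz => ?_⟩
  set p := γ s + (ρ / 2) • ν with hp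
  have hball : ρ / 2 ≤ dist p z := by
    by_contra! hcon
    obtain ⟨_, ⟨s₂, rfl⟩, hdist⟩ := hcpt.exists_infDist_eq_dist (range_nonempty γ) p
    obtain ⟨s', hs', hss'⟩ := hγ.periodic.exists_mem_Ico₀ hγ.period_pos s₂
    rw [hss'] at hdist
    have hle : ∀ y ∈ range γ, dist p (γ s') ≤ dist p y := fun y hy =>
      hdist ▸ Metric.infDist_le_dist_of_mem hy
    obtain ⟨w, hw, hwn⟩ := hF.exists_eq_of_inner_eq_zero
      (inner_deriv_eq_zero_of_nearest (hdiff s') fun t => hle _ (mem_range_self t))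
    obtain ⟨w₀, hw₀, hwn₀⟩ := hF.exists_eq_of_inner_eq_zero (s := s)
      (q := (ρ / 2) • ν) (by rw [inner_smul_left, hντ, mul_zero])
    have hn₀ : ‖w₀‖ = ρ / 2 := by
      rw [hwn₀, norm_smul, hν, mul_one, Real.norm_of_nonneg (by positivity)]
    have hn : ‖w‖ < ρ / 2 := by
      rw [hwn, ← dist_eq_norm]; exact (hle z hz).trans_lt hcon
    have heq : tubeMap γ n₁ n₂ (s', w) = tubeMap γ n₁ n₂ (s, w₀) := by
      simp only [tubeMap]
      rw [add_assoc, add_assoc, ← hw, ← hw₀]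
      simp [hp]
    have := hinj (⟨hs', by rw [mem_ball_zero_iff]; linarith⟩ : (s', w) ∈ _ ×ˢ _)
      (⟨hs, by rw [mem_ball_zero_iff]; linarith⟩ : (s, w₀) ∈ _ ×ˢ _) heq
    have hww : w = w₀ := (Prod.ext_iff.1 this).2
    rw [hww] at hn
    linarith
  -- Expanding the square cancels `(ρ / 2) ^ 2` and leaves exactly the quadratic bound.
  have hsq : (ρ / 2) ^ 2 ≤ ‖(ρ / 2) • ν - (z - γ s)‖ ^ 2 := by
    have : dist p z = ‖(ρ / 2) • ν - (z - γ s)‖ := by rw [dist_eq_norm, hp]; congr 1; abel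
    rw [← this]; gcongr
  rw [norm_sub_sq_real, norm_smul, hν, inner_smul_left, real_inner_comm,
    Real.norm_of_nonneg (by positivity)] at hsq
  simp only [conj_trivial, mul_one] at hsq
  rw [le_div_iff₀ hρ]
  linarith

lemma exists_unit_orthogonal (a b : E3) :
    ∃ ν : E3, ‖ν‖ = 1 ∧ inner ℝ ν a = 0 ∧ inner ℝ ν b = 0 := by
  set S := Submodule.span ℝ ({a, b} : Set E3) with hS
  have hlt : Module.finrank ℝ S < 3 := by
    have h1 : Module.finrank ℝ S ≤ ({a, b} : Finset E3).card := by
      have := finrank_span_finset_le_card (R := ℝ) ({a, b} : Finset E3)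
      rwa [Finset.coe_pair] at this
    exact (h1.trans Finset.card_le_two).trans_lt (by norm_num)
  have hne : Sᗮ ≠ ⊥ := by
    intro hbot
    rw [Submodule.orthogonal_eq_bot_iff] at hbot
    rw [hbot, finrank_top] at hlt
    simp at hlt
  obtain ⟨w, hw, hw0⟩ := Submodule.exists_mem_ne_zero_of_ne_bot hne
  have hw' : ∀ c ∈ ({a, b} : Set E3), inner ℝ w c = 0 := fun c hc =>
    Submodule.inner_left_of_mem_orthogonal (Submodule.subset_span hc) hw
  refine ⟨‖w‖⁻¹ • w, ?_, ?_, ?_⟩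
  · rw [norm_smul, norm_inv, norm_norm, inv_mul_cancel₀ (norm_ne_zero_iff.2 hw0)]
  · rw [inner_smul_left, hw' a (by simp), mul_zero]
  · rw [inner_smul_left, hw' b (by simp), mul_zero]

/-- A finite set of unit vectors which is `1/250`-dense in the unit sphere. -/
structure IsDirectionNet (N : Finset E3) : Prop where
  norm_eq_one : ∀ ν ∈ N, ‖ν‖ = 1
  exists_near : ∀ n : E3, ‖n‖ = 1 → ∃ ν ∈ N, ‖ν - n‖ ≤ 1 / 250

lemma exists_isDirectionNet : ∃ N : Finset E3, IsDirectionNet N := by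
  obtain ⟨t, hts, htf, hcov⟩ := (isCompact_sphere (0 : E3) 1).finite_cover_balls
    (e := 1 / 250) (by norm_num)
  refine ⟨htf.toFinset, fun ν hν => ?_, fun n hn => ?_⟩
  · simpa using hts (htf.mem_toFinset.1 hν)
  · obtain ⟨ν, hν, hnν⟩ := mem_iUnion₂.1 (hcov (by simpa using hn : n ∈ Metric.sphere (0 : E3) 1))
    refine ⟨ν, htf.mem_toFinset.2 hν, ?_⟩
    rw [← dist_eq_norm, dist_comm]
    exact (Metric.mem_ball.1 hnν).le

lemma norm_add_smul_sq {q ν : E3} (hν : ‖ν‖ = 1) (t : ℝ) :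
    ‖q + t • ν‖ ^ 2 = ‖q‖ ^ 2 + 2 * t * inner ℝ q ν + t ^ 2 := by
  rw [norm_add_sq_real, norm_smul, hν, inner_smul_right, mul_one, Real.norm_eq_abs, sq_abs]
  ring

lemma neg_le_inner_of_near {q ν ν₀ : E3} (hνν : ‖ν - ν₀‖ ≤ 1 / 250) :
    inner ℝ q ν₀ - ‖q‖ / 250 ≤ inner ℝ q ν := by
  have h1 : inner ℝ q ν = inner ℝ q ν₀ + inner ℝ q (ν - ν₀) := by rw [inner_sub_right]; ring
  have h2 := neg_le_of_abs_le (abs_real_inner_le_norm q (ν - ν₀))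
  have h3 : ‖q‖ * ‖ν - ν₀‖ ≤ ‖q‖ * (1 / 250) := by gcongr
  linarith

/-- Up to distance `13 ε`, the curve rises in direction `ν` by at most `13 / 250 * ε` from the net
error plus `169 / 2000 * ε` from curvature. -/
lemma inner_le_of_near {Γ : Set E3} {ρ ε : ℝ} (hε : 0 < ε) (hερ : 2000 * ε ≤ ρ) {y ν ν₀ : E3}
    (hν₀ : ∀ z ∈ Γ, inner ℝ (z - y) ν₀ ≤ ‖z - y‖ ^ 2 / ρ) (hνν : ‖ν - ν₀‖ ≤ 1 / 250)
    {z : E3} (hz : z ∈ Γ) (hzy : ‖z - y‖ ≤ 13 * ε) : inner ℝ (z - y) ν ≤ 4 / 25 * ε := by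
  have hρ : 0 < ρ := by linarith
  have h1 : inner ℝ (z - y) ν = inner ℝ (z - y) ν₀ + inner ℝ (z - y) (ν - ν₀) := by
    rw [inner_sub_right]; ring
  have h2 := real_inner_le_norm (z - y) (ν - ν₀)
  have h3 : ‖z - y‖ * ‖ν - ν₀‖ ≤ 13 * ε * (1 / 250) := by gcongr
  have h4 : ‖z - y‖ ^ 2 / ρ ≤ (13 * ε) ^ 2 / (2000 * ε) := by gcongr
  have h5 : (13 * ε) ^ 2 / (2000 * ε) = 169 / 2000 * ε := by field_simp; norm_num
  have := hν₀ z hz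
  linarith

/-- A point close to `Γ` can be moved away from `Γ` along one of finitely many directions. -/
lemma HasTangentBalls.exists_direction {Γ : Set E3} {ρ ε : ℝ} (hΓ : HasTangentBalls Γ ρ)
    (hε : 0 < ε) (hερ : 2000 * ε ≤ ρ) {N : Finset E3} (hN : IsDirectionNet N) {x : E3}
    (hx : Metric.infDist x Γ < 2 * ε) :
    ∃ ν ∈ N, 2 * ε ≤ Metric.infDist (x + (3 * ε) • ν) Γ ∧
      (ε ≤ Metric.infDist x Γ → ∀ t ∈ Icc 0 (3 * ε),
        Metric.infDist x Γ ^ 2 + t ^ 2 ≤ Metric.infDist (x + t • ν) Γ ^ 2) := by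
  obtain ⟨y, hy, hxy⟩ := hΓ.isCompact.exists_infDist_eq_dist hΓ.nonempty x
  obtain ⟨τ, hτ, hball⟩ := hΓ.tangent y hy
  have hort : inner ℝ (x - y) τ = 0 := hτ x fun z hz => hxy ▸ Metric.infDist_le_dist_of_mem hz
  have hdn : dist x y = ‖x - y‖ := dist_eq_norm x y
  -- The ideal direction points from the nearest point `y` to `x`; on the curve itself any normal
  -- will do.
  obtain ⟨n, hn, hnτ, hxn⟩ : ∃ n : E3, ‖n‖ = 1 ∧ inner ℝ n τ = 0 ∧ inner ℝ (x - y) n = ‖x - y‖ := by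
    by_cases h0 : x - y = 0
    · obtain ⟨n, hn, hnτ, -⟩ := exists_unit_orthogonal τ τ
      exact ⟨n, hn, hnτ, by simp [h0]⟩
    · have h0' : ‖x - y‖ ≠ 0 := norm_ne_zero_iff.2 h0
      refine ⟨‖x - y‖⁻¹ • (x - y), ?_, ?_, ?_⟩
      · rw [norm_smul, norm_inv, norm_norm, inv_mul_cancel₀ h0']
      · rw [inner_smul_left, hort, mul_zero]
      · rw [inner_smul_right, real_inner_self_eq_norm_sq]; field_simp
  obtain ⟨ν, hνN, hνn⟩ := hN.exists_near n hn
  have hν1 := hN.norm_eq_one ν hνN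
  set d := Metric.infDist x Γ with hd
  have hd0 : 0 ≤ d := Metric.infDist_nonneg
  have hdxy : ‖x - y‖ = d := by rw [hxy, hdn]
  have hnear : ∀ z ∈ Γ, ‖z - y‖ ≤ 13 * ε → d * (249 / 250) - 4 / 25 * ε ≤ inner ℝ (x - z) ν := by
    intro z hz hzy
    have h1 := inner_le_of_near hε hερ (hball n hn hnτ) hνn hz hzy
    have h2 := neg_le_inner_of_near (q := x - y) hνn
    have h3 : inner ℝ (x - z) ν = inner ℝ (x - y) ν - inner ℝ (z - y) ν := by
      rw [← inner_sub_left]; congr 1; abel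
    rw [hxn, hdxy] at h2
    linarith
  -- Curve points farther than `13 ε` from `y` cannot interfere: `13 - 2 - 3 = 8`.
  have hfar : ∀ z ∈ Γ, 13 * ε < ‖z - y‖ → ∀ t ∈ Icc 0 (3 * ε), 8 * ε ≤ dist (x + t • ν) z := by
    intro z hz hzy t ht
    have h1 : ‖t • ν‖ ≤ 3 * ε := by
      rw [norm_smul, hν1, mul_one, Real.norm_of_nonneg ht.1]; exact ht.2
    have h2 : ‖z - y‖ ≤ ‖x + t • ν - z‖ + ‖x - y‖ + ‖t • ν‖ := by
      calc ‖z - y‖ = ‖-(x + t • ν - z) + (x - y) + t • ν‖ := by congr 1; abel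
        _ ≤ _ := (norm_add₃_le).trans (by rw [norm_neg])
    rw [dist_eq_norm]
    linarith
  have heq : ∀ t z, dist (x + t • ν) z ^ 2 = dist x z ^ 2 + 2 * t * inner ℝ (x - z) ν + t ^ 2 := by
    intro t z
    rw [dist_eq_norm, dist_eq_norm, ← norm_add_smul_sq hν1]; congr 2; abel
  refine ⟨ν, hνN, ?_, fun hdε t ht => ?_⟩
  · refine (Metric.le_infDist hΓ.nonempty).2 fun z hz => ?_
    by_cases hzy : ‖z - y‖ ≤ 13 * ε
    · have h1 := hnear z hz hzy
      have h2 := heq (3 * ε) z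
      -- The square of the new distance is at least `9 ε ^ 2 - 24 / 25 * ε ^ 2`, which exceeds `(2
      -- ε) ^ 2`.
      have h3 : -(4 / 25) * ε ≤ inner ℝ (x - z) ν := by nlinarith
      refine le_of_sq_le_sq ?_ dist_nonneg
      rw [h2]
      nlinarith [sq_nonneg (dist x z)]
    · linarith [hfar z hz (not_le.1 hzy) (3 * ε) ⟨by positivity, le_rfl⟩]
  · obtain ⟨z, hz, hzd⟩ := hΓ.isCompact.exists_infDist_eq_dist hΓ.nonempty (x + t • ν)
    rw [hzd]
    by_cases hzy : ‖z - y‖ ≤ 13 * ε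
    · have h1 := hnear z hz hzy
      have h3 : 0 ≤ inner ℝ (x - z) ν := by linarith
      have h4 : d ≤ dist x z := Metric.infDist_le_dist_of_mem hz
      rw [heq]
      have : d ^ 2 ≤ dist x z ^ 2 := by gcongr
      have := mul_nonneg (mul_nonneg zero_le_two ht.1) h3
      linarith
    · have h1 := hfar z hz (not_le.1 hzy) t ht
      have h2 : d ^ 2 ≤ (2 * ε) ^ 2 := by gcongr
      have h3 : t ^ 2 ≤ (3 * ε) ^ 2 := pow_le_pow_left₀ ht.1 ht.2 2
      have h4 : (8 * ε) ^ 2 ≤ dist (x + t • ν) z ^ 2 := by gcongr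
      nlinarith

/-- Two points at distance at least `2 ε` from `Γ`, but close to a point of `Γ`, are connected by
three segments which stay away from `Γ`, the first and the last in the same direction. -/
lemma HasTangentBalls.exists_detour {Γ : Set E3} {ρ ε : ℝ} (hΓ : HasTangentBalls Γ ρ)
    (hε : 0 < ε) (hερ : 2000 * ε ≤ ρ) {N : Finset E3} (hN : IsDirectionNet N) {p p' y : E3}
    (hp : 2 * ε ≤ Metric.infDist p Γ) (hp' : 2 * ε ≤ Metric.infDist p' Γ) (hy : y ∈ Γ)
    (hpy : ‖p - y‖ ≤ 8 * ε) (hpy' : ‖p' - y‖ ≤ 8 * ε) :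
    ∃ ν ∈ N, (∀ t ∈ Icc 0 (3 * ε), ε < Metric.infDist (p + t • ν) Γ) ∧
      (∀ t ∈ Icc 0 (3 * ε), ε < Metric.infDist (p' + t • ν) Γ) ∧
      ∀ t ∈ Icc (0 : ℝ) 1, ε < Metric.infDist (p + (3 * ε) • ν + t • (p' - p)) Γ := by
  obtain ⟨τ, -, hball⟩ := hΓ.tangent y hy
  obtain ⟨ν₀, hν₀, hν₀τ, hν₀p, hν₀p'⟩ : ∃ ν : E3, ‖ν‖ = 1 ∧ inner ℝ ν τ = 0 ∧
      0 ≤ inner ℝ (p - y) ν ∧ 0 ≤ inner ℝ (p' - y) ν := by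
    -- Three dimensions leave a normal orthogonal to both `τ` and `p' - y`; its sign is free and is
    -- chosen to suit `p`. Both points then lie on one side of a plane touching the curve at `y`.
    obtain ⟨ν, h1, h2, h3⟩ := exists_unit_orthogonal τ (p' - y)
    rw [real_inner_comm] at h3
    rcases le_total 0 (inner ℝ (p - y) ν) with h | h
    · exact ⟨ν, h1, h2, h, h3.ge⟩
    · exact ⟨-ν, by simpa using h1, by simpa using h2, by simpa using h, by simp [h3]⟩
  obtain ⟨ν, hνN, hνν⟩ := hN.exists_near ν₀ hν₀
  have hν1 := hN.norm_eq_one ν hνN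
  have hnear : ∀ q : E3, 0 ≤ inner ℝ (q - y) ν₀ → ‖q - y‖ ≤ 8 * ε → ∀ z ∈ Γ,
      ‖z - y‖ ≤ 13 * ε → -(ε / 5) ≤ inner ℝ (q - z) ν := by
    intro q hq hqy z hz hzy
    have h1 := inner_le_of_near hε hερ (hball ν₀ hν₀ hν₀τ) hνν hz hzy
    have h2 := neg_le_inner_of_near (q := q - y) hνν
    have h3 : inner ℝ (q - z) ν = inner ℝ (q - y) ν - inner ℝ (z - y) ν := by
      rw [← inner_sub_left]; congr 1; abel
    linarith
  have hfar : ∀ q : E3, ‖q - y‖ ≤ 8 * ε → ∀ z ∈ Γ,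
      13 * ε < ‖z - y‖ → ∀ t ∈ Icc 0 (3 * ε), ε < dist (q + t • ν) z := by
    intro q hqy z hz hzy t ht
    have h1 : ‖t • ν‖ ≤ 3 * ε := by
      rw [norm_smul, hν1, mul_one, Real.norm_of_nonneg ht.1]; exact ht.2
    have h2 : ‖z - y‖ ≤ ‖q + t • ν - z‖ + ‖q - y‖ + ‖t • ν‖ := by
      calc ‖z - y‖ = ‖-(q + t • ν - z) + (q - y) + t • ν‖ := by congr 1; abel
        _ ≤ _ := (norm_add₃_le).trans (by rw [norm_neg])
    rw [dist_eq_norm]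
    linarith
  have heq : ∀ (q : E3) t z,
      dist (q + t • ν) z ^ 2 = dist q z ^ 2 + 2 * t * inner ℝ (q - z) ν + t ^ 2 := by
    intro q t z
    rw [dist_eq_norm, dist_eq_norm, ← norm_add_smul_sq hν1]; congr 2; abel
  have hend : ∀ q : E3, 2 * ε ≤ Metric.infDist q Γ → 0 ≤ inner ℝ (q - y) ν₀ → ‖q - y‖ ≤ 8 * ε →
      ∀ t ∈ Icc 0 (3 * ε), ε < Metric.infDist (q + t • ν) Γ := by
    intro q hq hq0 hqy t ht
    obtain ⟨z, hz, hzd⟩ := hΓ.isCompact.exists_infDist_eq_dist hΓ.nonempty (q + t • ν)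
    rw [hzd]
    by_cases hzy : ‖z - y‖ ≤ 13 * ε
    · have h1 := hnear q hq0 hqy z hz hzy
      have h2 : 2 * ε ≤ dist q z := hq.trans (Metric.infDist_le_dist_of_mem hz)
      have h3 : (2 * ε) ^ 2 ≤ dist q z ^ 2 := by gcongr
      have h4 := mul_le_mul_of_nonneg_left h1 ht.1
      refine lt_of_pow_lt_pow_left₀ 2 dist_nonneg ?_
      rw [heq]
      -- The lower bound is `4 ε ^ 2 - 2 t ε / 5 + t ^ 2`; completing the square leaves more than `ε
      -- ^ 2`.
      nlinarith [sq_nonneg (t - ε / 5), sq_pos_of_pos hε]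
    · exact hfar q hqy z hz (not_le.1 hzy) t ht
  refine ⟨ν, hνN, hend p hp hν₀p hpy, hend p' hp' hν₀p' hpy', fun t ht => ?_⟩
  set q : E3 := p + t • (p' - p) with hq
  have hqy : q - y = (1 - t) • (p - y) + t • (p' - y) := by rw [hq]; module
  have hqn : ‖q - y‖ ≤ 8 * ε := by
    have := (convex_closedBall (0 : E3) (8 * ε)) (mem_closedBall_zero_iff.2 hpy)
      (mem_closedBall_zero_iff.2 hpy') (sub_nonneg.2 ht.2) ht.1 (by ring)
    rw [hqy]; simpa using this
  have hq0 : 0 ≤ inner ℝ (q - y) ν₀ := by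
    rw [hqy, inner_add_left, inner_smul_left, inner_smul_left]
    exact add_nonneg (mul_nonneg (sub_nonneg.2 ht.2) hν₀p) (mul_nonneg ht.1 hν₀p')
  have hqe : p + (3 * ε) • ν + t • (p' - p) = q + (3 * ε) • ν := by rw [hq]; abel
  rw [hqe]
  obtain ⟨z, hz, hzd⟩ := hΓ.isCompact.exists_infDist_eq_dist hΓ.nonempty (q + (3 * ε) • ν)
  rw [hzd]
  by_cases hzy : ‖z - y‖ ≤ 13 * ε
  · have h1 := hnear q hq0 hqn z hz hzy
    refine lt_of_pow_lt_pow_left₀ 2 dist_nonneg ?_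
    rw [heq]
    nlinarith [sq_nonneg (dist q z)]
  · exact hfar q hqn z hz (not_le.1 hzy) _ ⟨by positivity, le_rfl⟩

-- The level set is covered by finitely many closed pieces, each pushed strictly off the level set
-- by every small positive shift in a fixed direction. Each piece thus has infinitely many disjoint
-- translates by bounded vectors, so it is null.
open scoped Pointwise in
lemma HasTangentBalls.volume_infDist_eq {Γ : Set E3} {ρ ε : ℝ} (hΓ : HasTangentBalls Γ ρ)
    (hε : 0 < ε) (hερ : 2000 * ε ≤ ρ) : volume {x : E3 | Metric.infDist x Γ = ε} = 0 := by
  obtain ⟨N, hN⟩ := exists_isDirectionNet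
  set S : E3 → Set E3 := fun ν => {x | Metric.infDist x Γ = ε ∧
    ∀ t ∈ Icc 0 (3 * ε), ε ^ 2 + t ^ 2 ≤ Metric.infDist (x + t • ν) Γ ^ 2} with hS
  have hcov : {x : E3 | Metric.infDist x Γ = ε} ⊆ ⋃ ν ∈ N, S ν := by
    intro x (hx : _ = ε)
    obtain ⟨ν, hν, -, h⟩ := hΓ.exists_direction hε hερ hN (x := x) (by rw [hx]; linarith)
    refine mem_iUnion₂.2 ⟨ν, hν, hx, fun t ht => ?_⟩
    have := h hx.ge t ht
    rwa [hx] at this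
  refine measure_mono_null hcov ((measure_biUnion_null_iff N.countable_toSet).2 fun ν hν => ?_)
  have hν1 := hN.norm_eq_one ν hν
  have hcl : IsClosed (S ν) := by
    have hc : Continuous fun x : E3 => Metric.infDist x Γ := Metric.continuous_infDist_pt Γ
    have : S ν = {x | Metric.infDist x Γ = ε} ∩ ⋂ t ∈ Icc 0 (3 * ε),
        {x | ε ^ 2 + t ^ 2 ≤ Metric.infDist (x + t • ν) Γ ^ 2} := by
      ext x; simp [hS]
    rw [this]
    refine (isClosed_eq hc continuous_const).inter (isClosed_biInter fun t _ => ?_)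
    exact isClosed_le continuous_const ((hc.comp (continuous_add_const _)).pow 2)
  have hdis : ∀ a ∈ Icc 0 (3 * ε), ∀ b ∈ Icc 0 (3 * ε), a < b →
      Disjoint (({a • ν} : Set E3) + S ν) (({b • ν} : Set E3) + S ν) := by
    intro a ha b hb hab
    rw [Set.disjoint_left]
    rintro x hxa hxb
    rw [singleton_add, mem_image] at hxa hxb
    obtain ⟨y, hy, rfl⟩ := hxa
    obtain ⟨z, hz, hyz⟩ := hxb
    have h1 := hz.2 (b - a) ⟨by linarith, by linarith [ha.1, hb.2]⟩
    have h2 : z + (b - a) • ν = y := by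
      have : b • ν + z - a • ν = y := by rw [hyz]; abel
      rw [← this]; module
    rw [h2, hy.1] at h1
    nlinarith
  have hmem : ∀ k : ℕ, 3 * ε / (k + 1) ∈ Icc 0 (3 * ε) := fun k =>
    ⟨by positivity, div_le_self (by positivity) (by linarith [(Nat.cast_nonneg k : (0 : ℝ) ≤ k)])⟩
  refine Measure.addHaar_eq_zero_of_disjoint_translates volume
    (fun k : ℕ => (3 * ε / (k + 1)) • ν) ?_ ?_ hcl.measurableSet
  · refine (Metric.isBounded_closedBall (x := (0 : E3)) (r := 3 * ε)).subset ?_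
    rintro _ ⟨k, rfl⟩
    rw [mem_closedBall_zero_iff, norm_smul, hν1, mul_one, Real.norm_of_nonneg (hmem k).1]
    exact (hmem k).2
  · intro i j hij
    rcases lt_or_gt_of_ne hij with h | h
    · refine (hdis _ (hmem j) _ (hmem i) ?_).symm
      gcongr
    · refine hdis _ (hmem i) _ (hmem j) ?_
      gcongr

/-! ### Shifting the function off the tube -/

lemma exists_measurable_selection (N : Finset E3) {p : E3 → E3 → Prop}
    (hp : ∀ w ∈ N, MeasurableSet {x | p w x}) :
    ∃ σ : E3 → E3, Measurable σ ∧ ∀ x, (∃ w ∈ N, p w x) → σ x ∈ N ∧ p (σ x) x := by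
  classical
  induction N using Finset.induction_on with
  | empty => exact ⟨fun _ => 0, measurable_const, by simp⟩
  | insert a N ha ih =>
    obtain ⟨σ, hσ, h⟩ := ih fun w hw => hp w (Finset.mem_insert_of_mem hw)
    refine ⟨fun x => if p a x then a else σ x,
      Measurable.ite (hp a (Finset.mem_insert_self _ _)) measurable_const hσ, fun x hx => ?_⟩
    by_cases hax : p a x
    · simp [hax]
    · obtain ⟨w, hw, hwx⟩ := hx
      rcases Finset.mem_insert.1 hw with rfl | hw
      · exact absurd hwx hax
      · have := h x ⟨w, hw, hwx⟩
        simp only [hax, if_false]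
        exact ⟨Finset.mem_insert_of_mem this.1, this.2⟩

/-- The points of `Ω` at distance greater than `ε` from `Γ`. -/
def tubeExterior (Ω Γ : Set E3) (ε : ℝ) : Set E3 := Ω ∩ {x | ε < Metric.infDist x Γ}

lemma isOpen_tubeExterior {Ω : Set E3} (hΩ : IsOpen Ω) (Γ : Set E3) (ε : ℝ) :
    IsOpen (tubeExterior Ω Γ ε) :=
  hΩ.inter (isOpen_lt continuous_const (Metric.continuous_infDist_pt Γ))

/-- `0` together with the directions of `N`, scaled by `3 ε`. -/
noncomputable def shiftVectors (N : Finset E3) (ε : ℝ) : Finset E3 :=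
  open scoped Classical in insert 0 (N.image fun ν => (3 * ε) • ν)

lemma card_shiftVectors_le (N : Finset E3) (ε : ℝ) : (shiftVectors N ε).card ≤ N.card + 1 := by
  classical
  unfold shiftVectors
  refine (Finset.card_insert_le _ _).trans (Nat.succ_le_succ ?_)
  convert Finset.card_image_le (s := N) (f := fun ν => (3 * ε) • ν)

lemma smul_mem_shiftVectors {N : Finset E3} {ν : E3} (hν : ν ∈ N) (ε : ℝ) :
    (3 * ε) • ν ∈ shiftVectors N ε := by
  classical
  simp only [shiftVectors, Finset.mem_insert, Finset.mem_image]
  exact Or.inr ⟨ν, hν, rfl⟩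

lemma zero_mem_shiftVectors (N : Finset E3) (ε : ℝ) : (0 : E3) ∈ shiftVectors N ε := by
  classical
  simp [shiftVectors]

lemma IsDirectionNet.norm_le_of_mem_shiftVectors {N : Finset E3} (hN : IsDirectionNet N) {ε : ℝ}
    (hε : 0 < ε) {w : E3} (hw : w ∈ shiftVectors N ε) : ‖w‖ ≤ 3 * ε := by
  classical
  simp only [shiftVectors, Finset.mem_insert, Finset.mem_image] at hw
  rcases hw with rfl | ⟨ν, hν, rfl⟩
  · simpa using hε.le
  · rw [norm_smul, hN.norm_eq_one ν hν, mul_one, Real.norm_of_nonneg (by positivity)]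

/-- A measurable shift moving every point to distance at least `2 ε` from `Γ`, along segments which
avoid the tube whenever they start outside of it. -/
lemma HasTangentBalls.exists_shift {Γ Ω : Set E3} {ρ ε δ : ℝ} (hΓ : HasTangentBalls Γ ρ)
    (hΩ : IsOpen Ω) (hε : 0 < ε) (hερ : 2000 * ε ≤ ρ) (hεδ : 20 * ε ≤ δ)
    (hΓΩ : ∀ x, Metric.infDist x Γ < δ → x ∈ Ω) {N : Finset E3} (hN : IsDirectionNet N) :
    ∃ σ : E3 → E3, Measurable σ ∧ ∀ x, σ x ∈ shiftVectors N ε ∧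
      2 * ε ≤ Metric.infDist (x + σ x) Γ ∧
      (x ∈ tubeExterior Ω Γ ε → x ∈ segSet (tubeExterior Ω Γ ε) (σ x)) ∧
      (2 * ε ≤ Metric.infDist x Γ → σ x = 0) := by
  have hc : Continuous fun x : E3 => Metric.infDist x Γ := Metric.continuous_infDist_pt Γ
  have hp : ∀ w ∈ shiftVectors N ε, MeasurableSet {x | 2 * ε ≤ Metric.infDist (x + w) Γ ∧
      (x ∈ tubeExterior Ω Γ ε → x ∈ segSet (tubeExterior Ω Γ ε) w) ∧
      (2 * ε ≤ Metric.infDist x Γ → w = 0)} := by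
    intro w _
    have hU := isOpen_tubeExterior hΩ Γ ε
    have h1 : MeasurableSet {x | 2 * ε ≤ Metric.infDist (x + w) Γ} :=
      (isClosed_le continuous_const (hc.comp (continuous_add_const w))).measurableSet
    have h2 : MeasurableSet {x | x ∈ tubeExterior Ω Γ ε → x ∈ segSet (tubeExterior Ω Γ ε) w} := by
      have : {x | x ∈ tubeExterior Ω Γ ε → x ∈ segSet (tubeExterior Ω Γ ε) w} =
          (tubeExterior Ω Γ ε)ᶜ ∪ segSet (tubeExterior Ω Γ ε) w := by
        ext x; simp [imp_iff_not_or]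
      rw [this]
      exact hU.measurableSet.compl.union (isOpen_segSet hU w).measurableSet
    have h3 : MeasurableSet {x : E3 | 2 * ε ≤ Metric.infDist x Γ → w = 0} := by
      by_cases hw : w = 0
      · simp [hw]
      · simp only [hw, imp_false, not_le]
        exact (isOpen_lt hc continuous_const).measurableSet
    exact h1.inter (h2.inter h3)
  obtain ⟨σ, hσ, h⟩ := exists_measurable_selection (shiftVectors N ε) hp
  refine ⟨σ, hσ, fun x => h x ?_⟩
  by_cases hx : 2 * ε ≤ Metric.infDist x Γ
  · refine ⟨0, zero_mem_shiftVectors N ε, by simpa using hx, fun hxU t _ => ?_, fun _ => rfl⟩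
    simpa using hxU
  · rw [not_le] at hx
    obtain ⟨ν, hν, h1, h2⟩ := hΓ.exists_direction hε hερ hN hx
    refine ⟨_, smul_mem_shiftVectors hν ε, h1, fun hxU t ht => ?_, fun h => absurd h hx.not_ge⟩
    have ht' : t * (3 * ε) ∈ Icc 0 (3 * ε) :=
      ⟨mul_nonneg ht.1 (by positivity), mul_le_of_le_one_left (by positivity) ht.2⟩
    have h3 := h2 (le_of_lt hxU.2) _ ht'
    rw [smul_smul]
    constructor
    · refine hΓΩ _ ?_
      have h4 := Metric.infDist_le_infDist_add_dist (s := Γ) (x := x + (t * (3 * ε)) • ν) (y := x)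
      rw [dist_eq_norm, add_sub_cancel_left, norm_smul, hN.norm_eq_one ν hν, mul_one,
        Real.norm_of_nonneg ht'.1] at h4
      linarith [ht'.2]
    · have h5 : ε ^ 2 < Metric.infDist x Γ ^ 2 := by
        have : ε < Metric.infDist x Γ := hxU.2
        gcongr
      exact lt_of_pow_lt_pow_left₀ 2 Metric.infDist_nonneg
        (by nlinarith [sq_nonneg (t * (3 * ε))])

/-- The density of the translation energy on a set. -/
noncomputable def shiftEnergy (U : Set E3) (u : E3 → E3) (h : E3) : E3 → ℝ≥0∞ :=
  (segSet U h).indicator fun x => ‖u (x + h) - u x‖ₑ ^ 2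

lemma measurable_shiftEnergy {U : Set E3} (hU : IsOpen U) {u : E3 → E3} (hu : Measurable u)
    (h : E3) : Measurable (shiftEnergy U u h) :=
  Measurable.indicator (by fun_prop) (isOpen_segSet hU h).measurableSet

lemma shiftEnergy_of_mem {U : Set E3} {u : E3 → E3} {h x : E3} (hx : x ∈ segSet U h) :
    shiftEnergy U u h x = ‖u (x + h) - u x‖ₑ ^ 2 := indicator_of_mem hx _

lemma enorm_sub_sq_le_three (a b c d : E3) :
    ‖d - a‖ₑ ^ 2 ≤ 3 * (‖b - a‖ₑ ^ 2 + ‖c - b‖ₑ ^ 2 + ‖c - d‖ₑ ^ 2) := by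
  have := enorm_sum_sq_le Finset.univ ![b - a, c - b, -(c - d)]
  simp only [Fin.sum_univ_three, Matrix.cons_val_zero, Matrix.cons_val_one, Matrix.cons_val,
    enorm_neg, Finset.card_univ, Fintype.card_fin] at this
  refine le_trans (le_of_eq ?_) (this.trans (le_of_eq ?_))
  · congr 2; abel
  · norm_num

/-- The pointwise estimate for the shifted function: increments by at most `ε` are bounded by
finitely many translation energies in the exterior of the tube. -/
lemma HasTangentBalls.enorm_sub_sq_le_sum {Γ Ω : Set E3} {ρ ε δ : ℝ} (hΓ : HasTangentBalls Γ ρ)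
    (hε : 0 < ε) (hερ : 2000 * ε ≤ ρ) (hεδ : 20 * ε ≤ δ)
    (hΓΩ : ∀ x, Metric.infDist x Γ < δ → x ∈ Ω) {N : Finset E3} (hN : IsDirectionNet N)
    {σ : E3 → E3} (hσ : ∀ x, σ x ∈ shiftVectors N ε)
    (hσ2 : ∀ x, 2 * ε ≤ Metric.infDist (x + σ x) Γ)
    (hσ0 : ∀ x, 2 * ε ≤ Metric.infDist x Γ → σ x = 0) (u : E3 → E3) {h x : E3} (hh : ‖h‖ ≤ ε)
    (hx : x ∈ segSet Ω h) :
    ‖u (x + h + σ (x + h)) - u (x + σ x)‖ₑ ^ 2 ≤ shiftEnergy (tubeExterior Ω Γ ε) u h x +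
      ∑ a ∈ shiftVectors N ε, ∑ b ∈ shiftVectors N ε, ∑ w ∈ shiftVectors N ε,
        3 * (shiftEnergy (tubeExterior Ω Γ ε) u w (x + a) +
          shiftEnergy (tubeExterior Ω Γ ε) u (h + b - a) (x + (a + w)) +
          shiftEnergy (tubeExterior Ω Γ ε) u w (x + (h + b))) := by
  rcases le_or_gt (4 * ε) (Metric.infDist x Γ) with hfar | hnear
  -- Far from the curve both shifts vanish and the segment from `x` to `x + h` stays at distance `3
  -- ε`, so the first summand suffices.
  · have hd : ∀ t ∈ Icc (0 : ℝ) 1, 3 * ε ≤ Metric.infDist (x + t • h) Γ := by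
      intro t ht
      have h1 := Metric.infDist_le_infDist_add_dist (s := Γ) (x := x) (y := x + t • h)
      have h2 : dist x (x + t • h) ≤ ε := by
        rw [dist_eq_norm, sub_add_cancel_left, norm_neg, norm_smul, Real.norm_of_nonneg ht.1]
        exact (mul_le_of_le_one_left (norm_nonneg _) ht.2).trans hh
      linarith
    have hmem : x ∈ segSet (tubeExterior Ω Γ ε) h := fun t ht =>
      ⟨hx t ht, by have := hd t ht; simp only [mem_ofPred_eq]; linarith⟩
    have h1 : σ x = 0 := hσ0 x (by linarith)
    have h2 : σ (x + h) = 0 := hσ0 _ (by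
      have := hd 1 ⟨zero_le_one, le_rfl⟩
      rw [one_smul] at this; linarith)
    rw [h1, h2, add_zero, add_zero, shiftEnergy_of_mem hmem]
    exact le_self_add
  · refine le_trans ?_ le_add_self
    obtain ⟨y, hy, hxy⟩ := hΓ.isCompact.exists_infDist_eq_dist hΓ.nonempty x
    rw [hxy, dist_eq_norm] at hnear
    set a := σ x with ha
    set b := σ (x + h) with hb
    have hna := hN.norm_le_of_mem_shiftVectors hε (hσ x)
    have hnb := hN.norm_le_of_mem_shiftVectors hε (hσ (x + h))
    -- Both shifted points lie within `4 ε + ε + 3 ε = 8 ε` of `y`, the radius required by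
    -- `exists_detour`.
    have hpy : ‖x + a - y‖ ≤ 8 * ε := by
      calc ‖x + a - y‖ = ‖(x - y) + a‖ := by congr 1; abel
        _ ≤ ‖x - y‖ + ‖a‖ := norm_add_le _ _
        _ ≤ _ := by linarith
    have hpy' : ‖x + h + b - y‖ ≤ 8 * ε := by
      calc ‖x + h + b - y‖ = ‖(x - y) + h + b‖ := by congr 1; abel
        _ ≤ ‖x - y‖ + ‖h‖ + ‖b‖ := norm_add₃_le
        _ ≤ _ := by linarith
    obtain ⟨ν, hν, h1, h2, h3⟩ := hΓ.exists_detour hε hερ hN (hσ2 x) (hσ2 (x + h)) hy hpy hpy'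
    have hν1 := hN.norm_eq_one ν hν
    have hin : ∀ q : E3, ‖q - y‖ < 20 * ε → q ∈ Ω := fun q hq =>
      hΓΩ q (by
        have := Metric.infDist_le_dist_of_mem (x := q) hy
        rw [dist_eq_norm] at this
        linarith)
    have hseg : ∀ q : E3, ‖q - y‖ ≤ 8 * ε →
        (∀ t ∈ Icc 0 (3 * ε), ε < Metric.infDist (q + t • ν) Γ) →
        q ∈ segSet (tubeExterior Ω Γ ε) ((3 * ε) • ν) := by
      intro q hq hqt t ht
      have ht' : t * (3 * ε) ∈ Icc 0 (3 * ε) :=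
        ⟨mul_nonneg ht.1 (by positivity), mul_le_of_le_one_left (by positivity) ht.2⟩
      rw [smul_smul]
      refine ⟨hin _ ?_, hqt _ ht'⟩
      calc ‖q + (t * (3 * ε)) • ν - y‖ = ‖(q - y) + (t * (3 * ε)) • ν‖ := by congr 1; abel
        _ ≤ ‖q - y‖ + ‖(t * (3 * ε)) • ν‖ := norm_add_le _ _
        _ < _ := by
          rw [norm_smul, hν1, mul_one, Real.norm_of_nonneg ht'.1]
          linarith [ht'.2]
    have hs1 := hseg _ hpy h1
    have hs2 := hseg _ hpy' h2
    have hs3 : x + (a + (3 * ε) • ν) ∈ segSet (tubeExterior Ω Γ ε) (h + b - a) := by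
      intro t ht
      have e1 : x + (a + (3 * ε) • ν) + t • (h + b - a) =
          x + a + (3 * ε) • ν + t • (x + h + b - (x + a)) := by
        rw [← add_assoc]; congr 2; abel
      rw [e1]
      refine ⟨hin _ ?_, h3 t ht⟩
      calc ‖x + a + (3 * ε) • ν + t • (x + h + b - (x + a)) - y‖
          = ‖((1 - t) • (x + a - y) + t • (x + h + b - y)) + (3 * ε) • ν‖ := by
            congr 1; module
        _ ≤ ‖(1 - t) • (x + a - y) + t • (x + h + b - y)‖ + ‖(3 * ε) • ν‖ := norm_add_le _ _
        _ ≤ 8 * ε + 3 * ε := by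
            gcongr
            · have := (convex_closedBall (0 : E3) (8 * ε)) (mem_closedBall_zero_iff.2 hpy)
                (mem_closedBall_zero_iff.2 hpy') (sub_nonneg.2 ht.2) ht.1 (by ring)
              simpa using this
            · rw [norm_smul, hν1, mul_one, Real.norm_of_nonneg (by positivity)]
        _ < _ := by linarith
    -- The detour goes out along `w`, across along `h + b - a`, and back along `w`, the last leg
    -- being read backwards.
    set w := (3 * ε) • ν with hw
    have hterm := enorm_sub_sq_le_three (u (x + a)) (u (x + a + w)) (u (x + h + b + w))
      (u (x + h + b))
    have e2 : x + (a + w) + (h + b - a) = x + h + b + w := by abel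
    rw [← shiftEnergy_of_mem hs1, ← shiftEnergy_of_mem hs2, ← e2, add_assoc x a w,
      ← shiftEnergy_of_mem hs3, add_assoc x h b] at hterm
    rw [add_assoc x h b]
    refine hterm.trans ?_
    -- The vectors `a`, `b`, `w` depend on `x`; bounding by the sum over all choices leaves fixed
    -- translations, which can be integrated.
    refine le_trans ?_ (Finset.single_le_sum_of_canonicallyOrdered (hσ x))
    refine le_trans ?_ (Finset.single_le_sum_of_canonicallyOrdered (hσ (x + h)))
    exact Finset.single_le_sum_of_canonicallyOrdered
      (f := fun w => 3 * (shiftEnergy (tubeExterior Ω Γ ε) u w (x + a) +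
          shiftEnergy (tubeExterior Ω Γ ε) u (h + b - a) (x + (a + w)) +
          shiftEnergy (tubeExterior Ω Γ ε) u w (x + (h + b)))) (smul_mem_shiftVectors hν ε)

lemma lintegral_add_sum_le {S : Finset E3} {f : E3 → ℝ≥0∞} (hf : Measurable f)
    {F : E3 → E3 → E3 → E3 → ℝ≥0∞} (hF : ∀ a b w, Measurable (F a b w)) {K : ℝ≥0∞}
    (hK : ∀ a ∈ S, ∀ b ∈ S, ∀ w ∈ S, ∫⁻ x, F a b w x ≤ K) :
    ∫⁻ x, (f x + ∑ a ∈ S, ∑ b ∈ S, ∑ w ∈ S, F a b w x) ≤ (∫⁻ x, f x) + S.card ^ 3 * K := by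
  rw [lintegral_add_left hf,
    lintegral_finsetSum S fun a _ => Finset.measurable_fun_sum S fun b _ =>
      Finset.measurable_fun_sum S fun w _ => hF a b w]
  gcongr
  calc ∑ a ∈ S, ∫⁻ x, ∑ b ∈ S, ∑ w ∈ S, F a b w x
      = ∑ a ∈ S, ∑ b ∈ S, ∑ w ∈ S, ∫⁻ x, F a b w x := by
        refine Finset.sum_congr rfl fun a _ => ?_
        rw [lintegral_finsetSum S fun b _ => Finset.measurable_fun_sum S fun w _ => hF a b w]
        exact Finset.sum_congr rfl fun b _ => lintegral_finsetSum S fun w _ => hF a b w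
    _ ≤ ∑ a ∈ S, ∑ b ∈ S, ∑ w ∈ S, K := by
        gcongr with a ha b hb w hw
        exact hK a ha b hb w hw
    _ = _ := by
        simp only [Finset.sum_const, nsmul_eq_mul]
        ring

/-- Integration of the pointwise bound. The three legs have length at most `3 ε`, `7 ε` and `3 ε`,
whence `201 = 3 * (9 + 49 + 9)`, for each of at most `(N.card + 1) ^ 3` triples. -/
lemma HasTangentBalls.translationBound {Γ Ω : Set E3} {ρ ε δ : ℝ} (hΓ : HasTangentBalls Γ ρ)
    (hΩ : IsOpen Ω) (hε : 0 < ε) (hε1 : ε ≤ 1) (hερ : 2000 * ε ≤ ρ) (hεδ : 20 * ε ≤ δ)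
    (hΓΩ : ∀ x, Metric.infDist x Γ < δ → x ∈ Ω) {N : Finset E3} (hN : IsDirectionNet N)
    {σ : E3 → E3} (hσm : Measurable σ) (hσ : ∀ x, σ x ∈ shiftVectors N ε)
    (hσ2 : ∀ x, 2 * ε ≤ Metric.infDist (x + σ x) Γ)
    (hσ0 : ∀ x, 2 * ε ≤ Metric.infDist x Γ → σ x = 0) {u : E3 → E3} (hu : Measurable u)
    {G : ℝ≥0∞} (hG : ∀ h, ∫⁻ x, shiftEnergy (tubeExterior Ω Γ ε) u h x ≤
      ENNReal.ofReal (‖h‖ ^ 2) * G) :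
    TranslationBound Ω (fun x => u (x + σ x)) ((1 + 201 * (N.card + 1) ^ 3) * G) := by
  refine TranslationBound.of_small hΩ (by fun_prop) hε hε1 fun h hh => ?_
  have hm := measurable_shiftEnergy (isOpen_tubeExterior hΩ Γ ε) hu
  set D := shiftEnergy (tubeExterior Ω Γ ε) u with hD
  have hmt : ∀ k a, Measurable fun x => D k (x + a) := fun k a =>
    (hm k).comp (measurable_add_const a)
  have hDt : ∀ k a (c : ℝ), 0 ≤ c → ‖k‖ ≤ c * ε →
      ∫⁻ x, D k (x + a) ≤ ENNReal.ofReal (c ^ 2) * (ENNReal.ofReal (ε ^ 2) * G) := by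
    intro k a c hc hk
    rw [lintegral_add_right_eq_self (D k) a, ← mul_assoc, ← ENNReal.ofReal_mul (by positivity),
      ← mul_pow]
    exact (hG k).trans (by gcongr)
  set K : ℝ≥0∞ := ENNReal.ofReal (ε ^ 2) * G with hK
  have hF : ∀ a b w, Measurable fun x =>
      3 * (D w (x + a) + D (h + b - a) (x + (a + w)) + D w (x + (h + b))) := fun a b w =>
    (((hmt w a).add (hmt _ _)).add (hmt w _)).const_mul 3
  have hterm : ∀ a ∈ shiftVectors N ε, ∀ b ∈ shiftVectors N ε, ∀ w ∈ shiftVectors N ε,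
      ∫⁻ x, 3 * (D w (x + a) + D (h + b - a) (x + (a + w)) + D w (x + (h + b))) ≤ 201 * K := by
    intro a ha b hb w hw
    have h1 := hN.norm_le_of_mem_shiftVectors hε ha
    have h2 := hN.norm_le_of_mem_shiftVectors hε hb
    have h3 := norm_sub_le (h + b) a
    have h4 := norm_add_le h b
    have h5 := hN.norm_le_of_mem_shiftVectors hε hw
    have hm3 : Measurable fun x =>
        D w (x + a) + D (h + b - a) (x + (a + w)) + D w (x + (h + b)) :=
      ((hmt w a).add (hmt _ _)).add (hmt w _)
    rw [lintegral_const_mul 3 hm3, lintegral_add_right _ (hmt w (h + b)),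
      lintegral_add_right _ (hmt (h + b - a) (a + w))]
    calc 3 * ((∫⁻ x, D w (x + a)) + (∫⁻ x, D (h + b - a) (x + (a + w))) +
          ∫⁻ x, D w (x + (h + b)))
        ≤ 3 * (ENNReal.ofReal (3 ^ 2) * K + ENNReal.ofReal (7 ^ 2) * K +
            ENNReal.ofReal (3 ^ 2) * K) := by
          gcongr
          · exact hDt w _ 3 (by norm_num) h5
          · exact hDt _ _ 7 (by norm_num) (by linarith)
          · exact hDt w _ 3 (by norm_num) h5
      _ = _ := by norm_num; ring
  have h0 : ∫⁻ x, D h x ≤ K := by simpa using hDt h 0 1 zero_le_one (by simpa using hh)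
  have hcard : ((shiftVectors N ε).card : ℝ≥0∞) ≤ N.card + 1 := by
    exact_mod_cast card_shiftVectors_le N ε
  calc ∫⁻ x in segSet Ω h, ‖u (x + h + σ (x + h)) - u (x + σ x)‖ₑ ^ 2
      ≤ ∫⁻ x in segSet Ω h, (D h x + ∑ a ∈ shiftVectors N ε, ∑ b ∈ shiftVectors N ε,
          ∑ w ∈ shiftVectors N ε,
            3 * (D w (x + a) + D (h + b - a) (x + (a + w)) + D w (x + (h + b)))) :=
        setLIntegral_mono' (isOpen_segSet hΩ h).measurableSet fun x hx =>
          hΓ.enorm_sub_sq_le_sum hε hερ hεδ hΓΩ hN hσ hσ2 hσ0 u hh hx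
    _ ≤ ∫⁻ x, (D h x + ∑ a ∈ shiftVectors N ε, ∑ b ∈ shiftVectors N ε,
          ∑ w ∈ shiftVectors N ε,
            3 * (D w (x + a) + D (h + b - a) (x + (a + w)) + D w (x + (h + b)))) :=
        setLIntegral_le_lintegral _ _
    _ ≤ (∫⁻ x, D h x) + (shiftVectors N ε).card ^ 3 * (201 * K) :=
        lintegral_add_sum_le (hm h) hF hterm
    _ ≤ K + (N.card + 1) ^ 3 * (201 * K) := by gcongr
    _ = _ := by rw [hK]; ring

/-- The Poincaré inequality outside of a tube, with some constant instead of the mean. -/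
lemma exists_lintegral_tubeExterior_sub_const_le {Ω : Set E3} (hΩ : IsBoundedLipschitzDomain Ω) :
    ∃ C : ℝ≥0∞, C ≠ ⊤ ∧ ∀ (Γ : Set E3) (ρ ε δ : ℝ), HasTangentBalls Γ ρ → 0 < ε → ε ≤ 1 →
      2000 * ε ≤ ρ → 20 * ε ≤ δ → (∀ x, Metric.infDist x Γ < δ → x ∈ Ω) →
      ∀ u : E3 → E3, Measurable u → ∀ G : ℝ≥0∞,
      (∀ h, ∫⁻ x in segSet (tubeExterior Ω Γ ε) h, ‖u (x + h) - u x‖ₑ ^ 2 ≤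
        ENNReal.ofReal (‖h‖ ^ 2) * G) →
      ∃ c : E3, ∫⁻ x in tubeExterior Ω Γ ε, ‖u x - c‖ₑ ^ 2 ≤ C * G := by
  obtain ⟨N, hN⟩ := exists_isDirectionNet
  obtain ⟨x₀, r₀, hr₀, -, C, hC, H⟩ := exists_linked_self_ball hΩ
  set B := Metric.ball x₀ r₀ with hB
  have hB0 : volume B ≠ 0 := (Metric.measure_ball_pos _ _ hr₀).ne'
  have hBt : volume B ≠ ⊤ := measure_ball_lt_top.ne
  refine ⟨(volume B)⁻¹ * (2 * volume B * (9 * (N.card + 1)) +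
    2 * (C * (1 + 201 * (N.card + 1) ^ 3))), by finiteness, ?_⟩
  intro Γ ρ ε δ hΓ hε hε1 hερ hεδ hΓΩ u hu G hG
  set U := tubeExterior Ω Γ ε with hU
  have hUo : IsOpen U := isOpen_tubeExterior hΩ.isOpen Γ ε
  obtain ⟨σ, hσm, hσ⟩ := hΓ.exists_shift hΩ.isOpen hε hερ hεδ hΓΩ hN
  have hG' : ∀ h, ∫⁻ x, shiftEnergy U u h x ≤ ENNReal.ofReal (‖h‖ ^ 2) * G := by
    intro h
    unfold shiftEnergy
    rw [lintegral_indicator (isOpen_segSet hUo h).measurableSet]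
    exact hG h
  have hT := hΓ.translationBound hΩ.isOpen hε hε1 hερ hεδ hΓΩ hN hσm (fun x => (hσ x).1)
    (fun x => (hσ x).2.1) (fun x => (hσ x).2.2.2) hu hG'
  set v : E3 → E3 := fun x => u (x + σ x) with hv
  have hvm : Measurable v := by fun_prop
  -- Each shift has length at most `3 ε ≤ 3`, so each of the finitely many energies is at most `9 *
  -- G`.
  have hlayer : ∫⁻ x in U, ‖u x - v x‖ₑ ^ 2 ≤ 9 * (N.card + 1) * G := by
    calc ∫⁻ x in U, ‖u x - v x‖ₑ ^ 2
        ≤ ∫⁻ x in U, ∑ w ∈ shiftVectors N ε, shiftEnergy U u w x := by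
          refine setLIntegral_mono' hUo.measurableSet fun x hx => ?_
          have h1 := shiftEnergy_of_mem (u := u) ((hσ x).2.2.1 hx)
          rw [← enorm_neg, neg_sub, hv, ← h1]
          exact Finset.single_le_sum_of_canonicallyOrdered
            (f := fun w => shiftEnergy U u w x) (hσ x).1
      _ ≤ ∫⁻ x, ∑ w ∈ shiftVectors N ε, shiftEnergy U u w x := setLIntegral_le_lintegral _ _
      _ = ∑ w ∈ shiftVectors N ε, ∫⁻ x, shiftEnergy U u w x :=
          lintegral_finsetSum _ fun w _ => measurable_shiftEnergy hUo hu w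
      _ ≤ ∑ w ∈ shiftVectors N ε, 9 * G := by
          gcongr with w hw
          refine (hG' w).trans ?_
          gcongr
          have h1 := hN.norm_le_of_mem_shiftVectors hε hw
          have h2 : ‖w‖ ^ 2 ≤ 9 := by nlinarith [norm_nonneg w]
          simpa using ENNReal.ofReal_le_ofReal h2
      _ = (shiftVectors N ε).card * (9 * G) := by rw [Finset.sum_const, nsmul_eq_mul]
      _ ≤ (N.card + 1) * (9 * G) := by
          have : ((shiftVectors N ε).card : ℝ≥0∞) ≤ N.card + 1 := by
            exact_mod_cast card_shiftVectors_le N ε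
          gcongr
      _ = _ := by ring
  have hF : Measurable (Function.uncurry fun (y x : E3) => ‖u x - v y‖ₑ ^ 2) := by
    unfold Function.uncurry; fun_prop
  have hF' : Measurable fun y => ∫⁻ x in U, ‖u x - v y‖ₑ ^ 2 := hF.lintegral_prod_right'
  have hdouble : ∫⁻ y in B, ∫⁻ x in U, ‖u x - v y‖ₑ ^ 2 ≤
      (2 * volume B * (9 * (N.card + 1)) + 2 * (C * (1 + 201 * (N.card + 1) ^ 3))) * G := by
    calc ∫⁻ y in B, ∫⁻ x in U, ‖u x - v y‖ₑ ^ 2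
        = ∫⁻ x in U, ∫⁻ y in B, ‖u x - v y‖ₑ ^ 2 := lintegral_lintegral_swap hF.aemeasurable
      _ ≤ ∫⁻ x in U, ∫⁻ y in B, (2 * ‖u x - v x‖ₑ ^ 2 + 2 * ‖v x - v y‖ₑ ^ 2) := by
          gcongr; exact enorm_sub_sq_le _ _ _
      _ = ∫⁻ x in U, (2 * volume B * ‖u x - v x‖ₑ ^ 2 + 2 * ∫⁻ y in B, ‖v x - v y‖ₑ ^ 2) := by
          congr 1; ext1 x
          rw [lintegral_add_left (by fun_prop), lintegral_const,
            lintegral_const_mul 2 (f := fun y => ‖v x - v y‖ₑ ^ 2) (by fun_prop)]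
          simp; ring
      _ = 2 * volume B * (∫⁻ x in U, ‖u x - v x‖ₑ ^ 2) +
            2 * ∫⁻ x in U, ∫⁻ y in B, ‖v x - v y‖ₑ ^ 2 := by
          rw [lintegral_add_left (by fun_prop), lintegral_const_mul _ (by fun_prop),
            lintegral_const_mul _ (measurable_lintegral_sub_sq hvm B)]
      _ ≤ 2 * volume B * (9 * (N.card + 1) * G) +
            2 * (C * ((1 + 201 * (N.card + 1) ^ 3) * G)) := by
          gcongr
          exact (lintegral_mono_set inter_subset_left).trans (H v hvm _ hT)
      _ = _ := by ring
  -- Some `y` in the ball does no worse than the average over the ball; its value `v y` serves as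
  -- the constant.
  obtain ⟨y, -, hy⟩ := exists_le_setLAverage (μ := volume) hB0 hBt hF'.aemeasurable
  refine ⟨v y, hy.trans ?_⟩
  rw [setLAverage_eq, ENNReal.div_eq_inv_mul, mul_assoc]
  gcongr

/-! ### From a constant to the mean, and from `Ω_ε` to the open exterior -/

/-- By Cauchy–Schwarz the mean is as close to `c` as `u` is in mean square; the factor is `2 + 2`.
-/
lemma lintegral_sub_average_sq_le {α : Type*} [MeasurableSpace α] {μ : Measure α}
    [IsFiniteMeasure μ] {u : α → E3} (hu : Integrable u μ) (c : E3) :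
    ∫⁻ x, ‖u x - ⨍ y, u y ∂μ‖ₑ ^ 2 ∂μ ≤ 4 * ∫⁻ x, ‖u x - c‖ₑ ^ 2 ∂μ := by
  rcases eq_or_ne μ 0 with rfl | hμ
  · simp
  have hμ0 : μ univ ≠ 0 := by simpa using hμ
  have hμt : μ univ ≠ ⊤ := measure_ne_top _ _
  have : NeZero μ := ⟨hμ⟩
  have huc : Integrable (fun x => u x - c) μ := hu.sub (integrable_const c)
  have hm : c - ⨍ y, u y ∂μ = -⨍ y, (u y - c) ∂μ := by
    rw [average_eq, average_eq, integral_sub hu (integrable_const c), integral_const, smul_sub,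
      smul_smul, inv_mul_cancel₀, one_smul]
    · abel
    · exact (ENNReal.toReal_pos hμ0 hμt).ne'
  have hmean : μ univ * ‖c - ⨍ y, u y ∂μ‖ₑ ^ 2 ≤ ∫⁻ x, ‖u x - c‖ₑ ^ 2 ∂μ := by
    have h1 : ‖c - ⨍ y, u y ∂μ‖ₑ = (μ univ)⁻¹ * ‖∫ y, (u y - c) ∂μ‖ₑ := by
      rw [hm, enorm_neg, average_eq, enorm_smul, measureReal_def]
      congr 1
      rw [← ENNReal.toReal_inv, Real.enorm_eq_ofReal ENNReal.toReal_nonneg,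
        ENNReal.ofReal_toReal (ENNReal.inv_ne_top.2 hμ0)]
    have h2 : ‖∫ y, (u y - c) ∂μ‖ₑ ^ 2 ≤ μ univ * ∫⁻ x, ‖u x - c‖ₑ ^ 2 ∂μ :=
      (pow_le_pow_left' (enorm_integral_le_lintegral_enorm _) 2).trans
        (sq_lintegral_le μ huc.aestronglyMeasurable.enorm)
    calc μ univ * ‖c - ⨍ y, u y ∂μ‖ₑ ^ 2
        = μ univ * (μ univ)⁻¹ * (μ univ)⁻¹ * ‖∫ y, (u y - c) ∂μ‖ₑ ^ 2 := by rw [h1]; ring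
      _ ≤ μ univ * (μ univ)⁻¹ * (μ univ)⁻¹ * (μ univ * ∫⁻ x, ‖u x - c‖ₑ ^ 2 ∂μ) := by gcongr
      _ = (μ univ * (μ univ)⁻¹) * (μ univ * (μ univ)⁻¹) * ∫⁻ x, ‖u x - c‖ₑ ^ 2 ∂μ := by ring
      _ = _ := by rw [ENNReal.mul_inv_cancel hμ0 hμt, one_mul, one_mul]
  calc ∫⁻ x, ‖u x - ⨍ y, u y ∂μ‖ₑ ^ 2 ∂μ
      ≤ ∫⁻ x, (2 * ‖u x - c‖ₑ ^ 2 + 2 * ‖c - ⨍ y, u y ∂μ‖ₑ ^ 2) ∂μ := by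
        gcongr; exact enorm_sub_sq_le _ _ _
    _ = 2 * (∫⁻ x, ‖u x - c‖ₑ ^ 2 ∂μ) + 2 * (μ univ * ‖c - ⨍ y, u y ∂μ‖ₑ ^ 2) := by
        rw [lintegral_add_right _ measurable_const, lintegral_const_mul' _ _ (by simp),
          lintegral_const]
        ring
    _ ≤ 2 * (∫⁻ x, ‖u x - c‖ₑ ^ 2 ∂μ) + 2 * ∫⁻ x, ‖u x - c‖ₑ ^ 2 ∂μ := by gcongr
    _ = _ := by ring

/-- A ball of radius `δ` about a point of `Γ` is connected, meets `Ω` and misses its frontier, so it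
lies in `Ω`. -/
lemma mem_of_infDist_lt {Ω Γ : Set E3} {δ : ℝ} (hΩ : IsOpen Ω) (hδ : 0 < δ)
    (hcpt : IsCompact Γ) (hne : Γ.Nonempty) (hΓ : Γ ⊆ Ω)
    (hd : ∀ y ∈ Γ, δ ≤ Metric.infDist y (frontier Ω)) {x : E3} (hx : Metric.infDist x Γ < δ) :
    x ∈ Ω := by
  obtain ⟨y, hy, hxy⟩ := hcpt.exists_infDist_eq_dist hne x
  rw [hxy] at hx
  refine (convex_ball y δ).isPreconnected.subset_of_closure_inter_subset hΩ
    ⟨y, Metric.mem_ball_self hδ, hΓ hy⟩ ?_ hx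
  rintro z ⟨hzΩ, hz⟩
  by_contra hzn
  have h1 := Metric.infDist_le_dist_of_mem (x := y)
    (show z ∈ frontier Ω from ⟨hzΩ, by rwa [hΩ.interior_eq]⟩)
  rw [Metric.mem_ball, dist_comm] at hz
  linarith [hd y hy]

lemma tubeExterior_subset_interior {Ω : Set E3} (hΩ : IsOpen Ω) (γ : ℝ → E3) (ε : ℝ) :
    tubeExterior Ω (range γ) ε ⊆ interior (tubeComplement Ω γ ε) := by
  refine interior_maximal ?_ (isOpen_tubeExterior hΩ _ ε)
  rintro x ⟨hx, hxε⟩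
  refine ⟨hx, fun h => ?_⟩
  rw [Metric.mem_thickening_iff_infDist_lt (range_nonempty γ)] at h
  exact lt_asymm h hxε

lemma HasTangentBalls.restrict_tubeComplement {γ : ℝ → E3} {Ω : Set E3} {ρ ε : ℝ}
    (hΓ : HasTangentBalls (range γ) ρ) (hΩ : IsOpen Ω) (hε : 0 < ε) (hερ : 2000 * ε ≤ ρ) :
    (volume : Measure E3).restrict (tubeComplement Ω γ ε) =
      volume.restrict (tubeExterior Ω (range γ) ε) := by
  refine Measure.restrict_congr_set ?_
  refine Filter.EventuallyLE.antisymm ?_ (LE.le.eventuallyLE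
    ((tubeExterior_subset_interior hΩ γ ε).trans interior_subset))
  have hae : ∀ᵐ x : E3, Metric.infDist x (range γ) ≠ ε := by
    rw [ae_iff]; simpa using hΓ.volume_infDist_eq hε hερ
  filter_upwards [hae] with x hx hxS
  refine ⟨hxS.1, lt_of_le_of_ne ?_ hx.symm⟩
  by_contra h
  exact hxS.2 ((Metric.mem_thickening_iff_infDist_lt (range_nonempty γ)).2 (not_le.1 h))

/-- The translation estimate for Sobolev functions outside of a tube, in terms of measurable
representatives. -/
lemma IsSobolevH1.exists_representative {Ω Γ S : Set E3} {ε : ℝ} (hΩ : IsOpen Ω)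
    (hΩb : Bornology.IsBounded Ω) {u : E3 → E3} {Du : Fin 3 → E3 → E3} (hu : IsSobolevH1 S u Du)
    (hS : (volume : Measure E3).restrict S = volume.restrict (tubeExterior Ω Γ ε))
    (hSi : tubeExterior Ω Γ ε ⊆ interior S) :
    ∃ v : E3 → E3, Measurable v ∧ v =ᵐ[volume.restrict (tubeExterior Ω Γ ε)] u ∧
      ∀ h, ∫⁻ x in segSet (tubeExterior Ω Γ ε) h, ‖v (x + h) - v x‖ₑ ^ 2 ≤
        ENNReal.ofReal (‖h‖ ^ 2) * ∫⁻ x in tubeExterior Ω Γ ε, ∑ j, ‖Du j x‖ₑ ^ 2 := by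
  set U := tubeExterior Ω Γ ε with hU
  have hUo : IsOpen U := isOpen_tubeExterior hΩ Γ ε
  have hUf : volume U ≠ ⊤ := (hΩb.subset inter_subset_left).measure_lt_top.ne
  have : IsFiniteMeasure (volume.restrict U) := ⟨by simpa using hUf.lt_top⟩
  -- Representatives are extended by zero; as `U` has finite measure they are integrable on the
  -- whole space, where the translation estimates are stated.
  have hrep : ∀ f : E3 → E3, MemLp f 2 (volume.restrict S) → ∃ g : E3 → E3, Measurable g ∧
      Integrable g ∧ g =ᵐ[volume.restrict U] f ∧ ∀ x, x ∉ U → g x = 0 := by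
    intro f hf
    rw [hS] at hf
    have hae : U.indicator (hf.1.mk f) =ᵐ[volume.restrict U] f :=
      (indicator_ae_eq_restrict hUo.measurableSet).trans hf.1.ae_eq_mk.symm
    refine ⟨U.indicator (hf.1.mk f), hf.1.stronglyMeasurable_mk.measurable.indicator
      hUo.measurableSet, ?_, hae, fun x hx => indicator_of_notMem hx _⟩
    rw [integrable_indicator_iff hUo.measurableSet]
    exact (hf.integrable one_le_two).congr hf.1.ae_eq_mk
  obtain ⟨v, hvm, hvi, hvu, hv0⟩ := hrep u hu.memLp
  choose g hgm hgi hgD hg0 using fun j => hrep (Du j) (hu.memLp_grad j)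
  have hglob : ∀ (θ : E3 → ℝ) (f f' : E3 → E3), f' =ᵐ[volume.restrict U] f →
      (∀ x, x ∉ U → f' x = 0) → ∫ x, θ x • f' x = ∫ x in S, θ x • f x := by
    intro θ f f' hff hf0
    rw [hS, ← setIntegral_eq_integral_of_forall_compl_eq_zero (s := U)
      (fun x hx => by rw [hf0 x hx, smul_zero])]
    refine integral_congr_ae ?_
    filter_upwards [hff] with x hx
    rw [hx]
  refine ⟨v, hvm, hvu, fun h => ?_⟩
  have key := lintegral_segSet_sub_sq_le_of_weak_deriv hUo hvi hgi hgm ?_ h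
  · refine key.trans (le_of_eq ?_)
    congr 1
    refine lintegral_congr_ae ?_
    filter_upwards [ae_all_iff.2 hgD] with x hx
    simp only [hx]
  · intro j φ hφ hc hs
    rw [hglob _ u v hvu hv0, hglob _ (Du j) (g j) (hgD j) (hg0 j)]
    exact hu.weak_deriv j φ hφ hc (hs.trans hSi)

end DislocationPoincare

theorem mainTheorem10 (Ω : Set DislocationPoincare.E3)
    (hΩ : DislocationPoincare.IsBoundedLipschitzDomain Ω)
    (M ρ : ℝ) (hρ : 0 < ρ) :
    ∃ C : ℝ, 0 < C ∧ ∀ δ : ℝ, 0 < δ → ∃ ε₀ : ℝ, 0 < ε₀ ∧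
      ∀ (γ : ℝ → DislocationPoincare.E3) (L : ℝ),
        DislocationPoincare.IsEmbeddedClosedCurve γ L →
        range γ ⊆ Ω →
        DislocationPoincare.cTwoNorm γ ≤ M →
        ENNReal.ofReal ρ ≤ DislocationPoincare.embeddednessRadius γ L →
        (∀ s, δ ≤ Metric.infDist (γ s) (frontier Ω)) →
        ∀ ε : ℝ, 0 < ε → ε < ε₀ →
          ∀ (u : DislocationPoincare.E3 → DislocationPoincare.E3)
            (Du : Fin 3 → DislocationPoincare.E3 → DislocationPoincare.E3),
            DislocationPoincare.IsSobolevH1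
              (DislocationPoincare.tubeComplement Ω γ ε) u Du →
            ∫ x in DislocationPoincare.tubeComplement Ω γ ε,
                ‖u x - ⨍ y in DislocationPoincare.tubeComplement Ω γ ε, u y‖ ^ 2
              ≤ C * ∫ x in DislocationPoincare.tubeComplement Ω γ ε,
                  ∑ j : Fin 3, ‖Du j x‖ ^ 2 := by
  obtain ⟨C, hC, H⟩ := DislocationPoincare.exists_lintegral_tubeExterior_sub_const_le hΩ
  -- The summand `1` only secures positivity. `C` is fixed before `δ`, which enters through `ε₀`
  -- alone.
  refine ⟨4 * C.toReal + 1, by positivity, fun δ hδ => ?_⟩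
  refine ⟨min 1 (min (ρ / 2000) (δ / 20)), by positivity, ?_⟩
  intro γ L hγ hγΩ _ hemb hdist ε hε hεlt u Du hu
  rw [lt_min_iff, lt_min_iff] at hεlt
  obtain ⟨hε1, hερ, hεδ⟩ := hεlt
  have hερ' : 2000 * ε ≤ ρ := by linarith
  have hΓ := hγ.hasTangentBalls hρ hemb
  have hΓΩ : ∀ x, Metric.infDist x (range γ) < δ → x ∈ Ω := fun x hx =>
    DislocationPoincare.mem_of_infDist_lt hΩ.isOpen hδ hΓ.isCompact hΓ.nonempty hγΩ
      (by rintro _ ⟨s, rfl⟩; exact hdist s) hx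
  have hres := hΓ.restrict_tubeComplement hΩ.isOpen hε hερ'
  obtain ⟨v, hvm, hvu, hv⟩ := hu.exists_representative hΩ.isOpen hΩ.isBounded hres
    (DislocationPoincare.tubeExterior_subset_interior hΩ.isOpen γ ε)
  obtain ⟨c, hc⟩ := H (range γ) ρ ε δ hΓ hε hε1.le hερ' (by linarith) hΓΩ v hvm _ hv
  have hmem := hu.memLp
  have hgrad := hu.memLp_grad
  rw [hres] at hmem hgrad ⊢
  set U := DislocationPoincare.tubeExterior Ω (range γ) ε with hU
  have hUf : volume U ≠ ⊤ := (hΩ.isBounded.subset inter_subset_left).measure_lt_top.ne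
  have : IsFiniteMeasure (volume.restrict U) := ⟨by simpa using hUf.lt_top⟩
  have hcu : ∫⁻ x in U, ‖u x - c‖ₑ ^ 2 ≤ C * ∫⁻ x in U, ∑ j, ‖Du j x‖ₑ ^ 2 := by
    refine le_trans (le_of_eq (lintegral_congr_ae ?_)) hc
    filter_upwards [hvu] with x hx
    rw [hx]
  have hmean := (DislocationPoincare.lintegral_sub_average_sq_le
    (hmem.integrable one_le_two) c).trans (mul_le_mul_right hcu 4)
  have hGi : Integrable (fun x => ∑ j, ‖Du j x‖ ^ 2) (volume.restrict U) :=
    integrable_finsetSum _ fun j _ => (hgrad j).integrable_norm_pow two_ne_zero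
  have hG : ENNReal.ofReal (∫ x in U, ∑ j, ‖Du j x‖ ^ 2) = ∫⁻ x in U, ∑ j, ‖Du j x‖ₑ ^ 2 := by
    rw [ofReal_integral_eq_lintegral_ofReal hGi (Filter.Eventually.of_forall fun x =>
      Finset.sum_nonneg fun j _ => by positivity)]
    congr 1; ext1 x
    rw [ENNReal.ofReal_sum_of_nonneg (by intros; positivity)]
    simp [ENNReal.ofReal_pow]
  have hG0 : 0 ≤ ∫ x in U, ∑ j, ‖Du j x‖ ^ 2 :=
    integral_nonneg fun x => Finset.sum_nonneg fun j _ => by positivity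
  have hL : ENNReal.ofReal (∫ x in U, ‖u x - ⨍ y in U, u y‖ ^ 2) =
      ∫⁻ x in U, ‖u x - ⨍ y in U, u y‖ₑ ^ 2 := by
    have hi : Integrable (fun x => ‖u x - ⨍ y in U, u y‖ ^ 2) (volume.restrict U) :=
      (hmem.sub (memLp_const _)).integrable_norm_pow two_ne_zero
    rw [ofReal_integral_eq_lintegral_ofReal hi
      (Filter.Eventually.of_forall fun x => by positivity)]
    congr 1; ext1 x
    simp [ENNReal.ofReal_pow]
  rw [← hL, ← hG, ← mul_assoc] at hmean
  have hreal : ∫ x in U, ‖u x - ⨍ y in U, u y‖ ^ 2 ≤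
      4 * C.toReal * ∫ x in U, ∑ j, ‖Du j x‖ ^ 2 := by
    rw [← ENNReal.ofReal_le_ofReal_iff (by positivity), ENNReal.ofReal_mul (by positivity),
      ENNReal.ofReal_mul (by positivity), ENNReal.ofReal_toReal hC]
    simpa using hmean
  linarith
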